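/- Let $\widetilde{\mathcal P}_+^\uparrow=\mathbb R^{1+3}\rtimes \mathrm{SL}(2,\mathbb C)$ be the universal cover of the Poincaré group, acting on Minkowski space by $(a,A)x=a+\Lambda(A)x$, where $x_\sim=x_0\mathbf 1+\sum_i x_i\sigma_i$ and $(\Lambda(A)x)_\sim=Ax_\sim A^*$. Let $W_3=\{x:|x_0|<x_3\}$, $r_1(\pi)=e^{i\frac{\pi}{2}\sigma_1}$, $G_3^0=\{A\in \mathrm{SL}(2,\mathbb C):\Lambda(A)W_3=W_3\}$, $\tilde G_3^0=\langle G_3^0,r_1(\pi)\rangle$, $G_3=\mathbb R^{1+3}\rtimes G_3^0$ and $\tilde G_3=\mathbb R^{1+3}\rtimes\tilde G_3^0$. For $r>0$ and $n\in\{0,1,2,3\}$ let $$W_{r,n}=\mathrm{Ind}_{\mathbb R^{1+3}\rtimes\langle r_1(\pi)\rangle}^{\tilde G_3}(\chi_{q_r}\cdot V_n),\qquad q_r=(r,r,0,0),\quad \chi_{q_r}(x)=e^{i q_r\cdot x},\quad V_n(r_1(\pi))=i^n,$$ where $q\cdot x$ is the Minkowski product of signature $(+,-,-,-)$. For a wedge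 $W=gW_3$, $g\in\widetilde{\mathcal P}_+^\uparrow$, put $G_W=gG_3g^{-1}$, $\tilde G_W=g\tilde G_3g^{-1}$, and regard $W_{r,n}$ as the representation $h\mapsto W_{r,n}(g^{-1}hg)$ of $\tilde G_W$; let $W'$ be the (open) spacelike complement of $W$. A unitary representation $U$ of $\tilde G_W$ satisfies the modularity condition if $$U(r_W)\in U(G_W)''\quad\text{for } r_W\in\tilde G_W \text{ with } r_WW=W'.$$ Let $\mu$ be a positive Borel measure on $\mathbb R^+=(0,\infty)$ and let $r\mapsto U_r$ be a $\mu$-measurable field of unitary representations of $\tilde G_W$ on a $\mu$-measurable field of Hilbert spaces $r\mapsto\mathcal H(r)$ such that, for ($\mu$-almost) every $r$, $U_r$ is unitarily equivalent to a (finite or infinite) multiple of $W_{r,n}$ for some $n=n(r)\in\{0,1,2,3\}$. Then $U=\int^{\oplus}_{\mathbb R^+}U_r\,d\mu(r)$ satisfies the modularity condition, for every $r_W\in\tilde G_W$ with $r_WW=W'$ (such elements exist). -/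

import Mathlib

open MeasureTheory Filter Topology
open scoped ENNReal InnerProductSpace

noncomputable section

namespace MasslessMC

/-! ### Square-integrable sections -/

/-- A complex vector space `F` whose elements are read, through `ev`, as sections `x ↦ ev f x` of a
field of inner product spaces `E x` over a measure space, all of them with measurable norm. -/
structure SectionSpace {X : Type*} [MeasurableSpace X] (μ : Measure X) (E : X → Type*)
    [∀ x, NormedAddCommGroup (E x)] [∀ x, InnerProductSpace ℂ (E x)]
    (F : Type*) [AddCommGroup F] [Module ℂ F] where
  ev : F →ₗ[ℂ] (∀ x, E x)
  aemeasurable_norm : ∀ f, AEMeasurable (fun x => ‖ev f x‖) μ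

namespace SectionSpace

variable {X : Type*} [MeasurableSpace X] {μ : Measure X} {E : X → Type*}
  [∀ x, NormedAddCommGroup (E x)] [∀ x, InnerProductSpace ℂ (E x)]
  {F : Type*} [AddCommGroup F] [Module ℂ F] (Γ : SectionSpace μ E F)

/-- `∫ ‖f(x)‖² dμ(x) ∈ [0, ∞]`. -/
def energy (f : F) : ℝ≥0∞ := ∫⁻ x, ENNReal.ofReal (‖Γ.ev f x‖ ^ 2) ∂μ

lemma aemeasurable_inner (f g : F) :
    AEMeasurable (fun x => (⟪Γ.ev f x, Γ.ev g x⟫_ℂ : ℂ)) μ := by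
  have h : (fun x => (⟪Γ.ev f x, Γ.ev g x⟫_ℂ : ℂ)) = fun x =>
      (((‖Γ.ev (f + g) x‖ : ℂ) ^ 2 - (‖Γ.ev (f - g) x‖ : ℂ) ^ 2
        + ((‖Γ.ev (f - Complex.I • g) x‖ : ℂ) ^ 2 - (‖Γ.ev (f + Complex.I • g) x‖ : ℂ) ^ 2)
          * Complex.I) / 4) := by
    funext x
    rw [inner_eq_sum_norm_sq_div_four]
    simp
  rw [h]
  have hm := fun f => Complex.measurable_ofReal.comp_aemeasurable (Γ.aemeasurable_norm f)
  simp only [Function.comp_def] at hm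
  exact ((((hm _).pow_const 2).sub ((hm _).pow_const 2)).add
    ((((hm _).pow_const 2).sub ((hm _).pow_const 2)).mul_const _)).div_const _

/-- The square-integrable sections. -/
def sqInt : Submodule ℂ F where
  carrier := {f | Γ.energy f < ∞}
  zero_mem' := by simp [energy]
  add_mem' := by
    intro f g hf hg
    have hm := (Γ.aemeasurable_norm f).pow_const 2 |>.ennreal_ofReal
    have : Γ.energy (f + g) ≤ 2 * (Γ.energy f + Γ.energy g) := by
      unfold energy
      rw [← lintegral_add_left' hm, ← lintegral_const_mul' _ _ (by simp)]
      refine lintegral_mono fun x => ?_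
      rw [← ENNReal.ofReal_add (by positivity) (by positivity),
        show (2 : ℝ≥0∞) = ENNReal.ofReal 2 by simp, ← ENNReal.ofReal_mul (by norm_num)]
      refine ENNReal.ofReal_le_ofReal ?_
      have h1 : ‖Γ.ev (f + g) x‖ ≤ ‖Γ.ev f x‖ + ‖Γ.ev g x‖ := by
        simpa using norm_add_le (Γ.ev f x) (Γ.ev g x)
      nlinarith [norm_nonneg (Γ.ev (f + g) x), sq_nonneg (‖Γ.ev f x‖ - ‖Γ.ev g x‖)]
    exact this.trans_lt (ENNReal.mul_lt_top (by simp) (ENNReal.add_lt_top.2 ⟨hf, hg⟩))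
  smul_mem' := by
    intro c f hf
    have : Γ.energy (c • f) = ENNReal.ofReal (‖c‖ ^ 2) * Γ.energy f := by
      unfold energy
      rw [← lintegral_const_mul' _ _ (by simp)]
      refine lintegral_congr fun x => ?_
      rw [← ENNReal.ofReal_mul (by positivity)]
      simp [norm_smul, mul_pow]
    show Γ.energy (c • f) < ∞
    rw [this]
    exact ENNReal.mul_lt_top (by simp) hf

/-- The square-integrable sections, carrying the seminorm and semi-inner product of `L²`. -/
def PreL2 : Type _ := Γ.sqInt

/-- A square-integrable section as an element of `Γ.PreL2`. -/
def toPre (f : F) (hf : Γ.energy f < ∞) : Γ.PreL2 := ⟨f, hf⟩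

instance : AddCommGroup Γ.PreL2 := inferInstanceAs (AddCommGroup Γ.sqInt)
instance : Module ℂ Γ.PreL2 := inferInstanceAs (Module ℂ Γ.sqInt)

/-- The section underlying an element of `Γ.PreL2`. -/
def sec : Γ.PreL2 →ₗ[ℂ] F := Γ.sqInt.subtype

lemma sec_injective : Function.Injective Γ.sec := Subtype.val_injective

@[simp] lemma sec_toPre (f : F) (hf : Γ.energy f < ∞) : Γ.sec (Γ.toPre f hf) = f := rfl

lemma energy_sec_lt (f : Γ.PreL2) : Γ.energy (Γ.sec f) < ∞ := f.2

lemma integrable_sq {f : F} (hf : f ∈ Γ.sqInt) : Integrable (fun x => ‖Γ.ev f x‖ ^ 2) μ := by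
  refine ⟨((Γ.aemeasurable_norm f).pow_const 2).aestronglyMeasurable, ?_⟩
  rw [hasFiniteIntegral_iff_ofReal (Eventually.of_forall fun x => by positivity)]
  exact hf

lemma integrable_inner (f g : Γ.PreL2) :
    Integrable (fun x => (⟪Γ.ev (Γ.sec f) x, Γ.ev (Γ.sec g) x⟫_ℂ : ℂ)) μ := by
  refine ((Γ.integrable_sq (Γ.energy_sec_lt f)).add (Γ.integrable_sq (Γ.energy_sec_lt g))).mono'
    (Γ.aemeasurable_inner _ _).aestronglyMeasurable (Eventually.of_forall fun x => ?_)
  have := norm_inner_le_norm (𝕜 := ℂ) (Γ.ev (Γ.sec f) x) (Γ.ev (Γ.sec g) x)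
  simp only [Pi.add_apply]
  nlinarith [sq_nonneg (‖Γ.ev (Γ.sec f) x‖ - ‖Γ.ev (Γ.sec g) x‖), sq_nonneg (‖Γ.ev (Γ.sec f) x‖),
    sq_nonneg (‖Γ.ev (Γ.sec g) x‖)]

/-- `⟪f, g⟫ = ∫ ⟪f(x), g(x)⟫ dμ(x)`. -/
instance core : PreInnerProductSpace.Core ℂ Γ.PreL2 where
  inner f g := ∫ x, (⟪Γ.ev (Γ.sec f) x, Γ.ev (Γ.sec g) x⟫_ℂ : ℂ) ∂μ
  conj_inner_symm f g := by
    rw [← integral_conj]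
    simp
  re_inner_nonneg f := by
    have h := integral_re (Γ.integrable_inner f f)
    rw [← h]
    exact integral_nonneg fun x => inner_self_nonneg
  add_left f g h := by
    rw [← integral_add (Γ.integrable_inner f h) (Γ.integrable_inner g h)]
    refine integral_congr_ae (Eventually.of_forall fun x => ?_)
    have : Γ.sec (f + g) = (Γ.sec f) + (Γ.sec g) := rfl
    simp [this]
  smul_left f g c := by
    rw [← integral_const_mul]
    refine integral_congr_ae (Eventually.of_forall fun x => ?_)
    have : Γ.sec (c • f) = c • (Γ.sec f) := rfl
    simp [this, mul_comm]

instance : SeminormedAddCommGroup Γ.PreL2 :=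
  InnerProductSpace.Core.toSeminormedAddCommGroup (𝕜 := ℂ)

instance : InnerProductSpace ℂ Γ.PreL2 := InnerProductSpace.ofCore Γ.core

/-- The Hilbert space of square-integrable sections modulo sections that vanish almost everywhere. -/
abbrev L2 : Type _ := SeparationQuotient Γ.PreL2

lemma inner_def (f g : Γ.PreL2) :
    (⟪f, g⟫_ℂ : ℂ) = ∫ x, (⟪Γ.ev (Γ.sec f) x, Γ.ev (Γ.sec g) x⟫_ℂ : ℂ) ∂μ := rfl

lemma ofReal_norm_sq (f : Γ.PreL2) : ENNReal.ofReal (‖f‖ ^ 2) = Γ.energy (Γ.sec f) := by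
  have h1 : ‖f‖ ^ 2 = ∫ x, ‖Γ.ev (Γ.sec f) x‖ ^ 2 ∂μ := by
    rw [← inner_self_eq_norm_sq (𝕜 := ℂ), inner_def, ← integral_re (Γ.integrable_inner f f)]
    exact integral_congr_ae (Eventually.of_forall fun x => inner_self_eq_norm_sq _)
  rw [h1, ofReal_integral_eq_lintegral_ofReal (Γ.integrable_sq (Γ.energy_sec_lt f))
    (Eventually.of_forall fun x => by positivity)]
  rfl

/-- The space `L²` is complete as soon as almost everywhere pointwise limits of sections are again
represented by sections. -/
theorem completeSpace_L2
    (hlim : ∀ f : ℕ → F, (∀ᵐ x ∂μ, CauchySeq fun n => Γ.ev (f n) x) →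
      ∃ g : F, ∀ᵐ x ∂μ, Tendsto (fun n => Γ.ev (f n) x) atTop (𝓝 (Γ.ev g x))) :
    CompleteSpace Γ.L2 := by
  suffices h : CompleteSpace Γ.PreL2 from inferInstance
  refine Metric.complete_of_convergent_controlled_sequences (fun k => (1 / 4 : ℝ) ^ k)
    (fun k => by positivity) fun u hu => ?_
  have hstep : ∀ k, Γ.energy (Γ.sec (u (k + 1)) - Γ.sec (u k)) ≤ ENNReal.ofReal ((1 / 16) ^ k) := by
    intro k
    have h1 : ‖u (k + 1) - u k‖ ≤ (1 / 4 : ℝ) ^ k := by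
      rw [← dist_eq_norm]
      exact (hu k (k + 1) k (Nat.le_succ k) le_rfl).le
    have h2 := Γ.ofReal_norm_sq (u (k + 1) - u k)
    have h3 : Γ.sec (u (k + 1) - u k) = Γ.sec (u (k + 1)) - Γ.sec (u k) := rfl
    rw [h3] at h2
    rw [← h2]
    refine ENNReal.ofReal_le_ofReal ?_
    calc ‖u (k + 1) - u k‖ ^ 2 ≤ ((1 / 4 : ℝ) ^ k) ^ 2 := by gcongr
      _ = (1 / 16) ^ k := by rw [← pow_mul, mul_comm, pow_mul]; norm_num
  have hmeas : ∀ f, AEMeasurable (fun x => ENNReal.ofReal (‖Γ.ev f x‖ ^ 2)) μ := fun f =>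
    ((Γ.aemeasurable_norm f).pow_const 2).ennreal_ofReal
  have hsum : ∫⁻ x, ∑' k : ℕ, ENNReal.ofReal (4 ^ k) *
      ENNReal.ofReal (‖Γ.ev (Γ.sec (u (k + 1)) - Γ.sec (u k)) x‖ ^ 2) ∂μ ≠ ∞ := by
    rw [lintegral_tsum fun k => (hmeas _).const_mul _]
    have hle : ∀ k : ℕ, ∫⁻ x, ENNReal.ofReal (4 ^ k) *
        ENNReal.ofReal (‖Γ.ev (Γ.sec (u (k + 1)) - Γ.sec (u k)) x‖ ^ 2) ∂μ
          ≤ ENNReal.ofReal ((1 / 4) ^ k) := by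
      intro k
      rw [lintegral_const_mul' _ _ (by simp)]
      calc ENNReal.ofReal (4 ^ k) * Γ.energy (Γ.sec (u (k + 1)) - Γ.sec (u k))
          ≤ ENNReal.ofReal (4 ^ k) * ENNReal.ofReal ((1 / 16) ^ k) := by gcongr; exact hstep k
        _ = ENNReal.ofReal ((1 / 4) ^ k) := by
          rw [← ENNReal.ofReal_mul (by positivity), ← mul_pow]; norm_num
    refine ne_top_of_le_ne_top ?_ (ENNReal.tsum_le_tsum hle)
    rw [← ENNReal.ofReal_tsum_of_nonneg (fun k => by positivity)
      (summable_geometric_of_lt_one (by norm_num) (by norm_num))]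
    simp
  have hcauchy : ∀ᵐ x ∂μ, CauchySeq fun n => Γ.ev (Γ.sec (u n)) x := by
    filter_upwards [ae_lt_top' (AEMeasurable.tsum fun k => (hmeas _).const_mul _) hsum]
      with x hx
    set C := (∑' k : ℕ, ENNReal.ofReal (4 ^ k) *
      ENNReal.ofReal (‖Γ.ev (Γ.sec (u (k + 1)) - Γ.sec (u k)) x‖ ^ 2)).toReal with hC
    have hC0 : 0 ≤ C := ENNReal.toReal_nonneg
    refine cauchySeq_of_le_geometric (1 / 2) (Real.sqrt C) (by norm_num) fun k => ?_
    have h1 : 4 ^ k * ‖Γ.ev (Γ.sec (u (k + 1)) - Γ.sec (u k)) x‖ ^ 2 ≤ C := by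
      have h2 := ENNReal.toReal_mono hx.ne (ENNReal.le_tsum (f := fun k : ℕ => ENNReal.ofReal (4 ^ k) *
        ENNReal.ofReal (‖Γ.ev (Γ.sec (u (k + 1)) - Γ.sec (u k)) x‖ ^ 2)) k)
      rwa [← ENNReal.ofReal_mul (by positivity), ENNReal.toReal_ofReal (by positivity)] at h2
    have h3 : (2 ^ k * ‖Γ.ev (Γ.sec (u (k + 1)) - Γ.sec (u k)) x‖) ≤ Real.sqrt C := by
      refine Real.le_sqrt_of_sq_le ?_
      rw [mul_pow, ← pow_mul, mul_comm k 2, pow_mul]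
      norm_num
      simpa using h1
    rw [dist_comm, dist_eq_norm]
    have h4 : Γ.ev (Γ.sec (u (k + 1))) x - Γ.ev (Γ.sec (u k)) x = Γ.ev (Γ.sec (u (k + 1)) - Γ.sec (u k)) x := by simp
    rw [h4, one_div, inv_pow, ← div_eq_mul_inv, le_div_iff₀ (by positivity),
      mul_comm]
    exact h3
  obtain ⟨g, hg⟩ := hlim (fun n => Γ.sec (u n)) hcauchy
  have hfatou : ∀ k, Γ.energy (g - Γ.sec (u k)) ≤ ENNReal.ofReal ((1 / 16) ^ k) := by
    intro k
    have h1 : Γ.energy (g - Γ.sec (u k)) = ∫⁻ x, liminf (fun n =>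
        ENNReal.ofReal (‖Γ.ev (Γ.sec (u n) - Γ.sec (u k)) x‖ ^ 2)) atTop ∂μ := by
      refine lintegral_congr_ae ?_
      filter_upwards [hg] with x hx
      refine (Tendsto.liminf_eq ?_).symm
      refine ENNReal.tendsto_ofReal (Tendsto.pow (Tendsto.norm ?_) 2)
      simpa using hx.sub_const (Γ.ev (Γ.sec (u k)) x)
    rw [h1]
    refine (lintegral_liminf_le' fun n => hmeas _).trans ?_
    refine liminf_le_of_frequently_le' (Eventually.frequently ?_)
    filter_upwards [eventually_ge_atTop k] with n hn
    have h2 : ‖u n - u k‖ ≤ (1 / 4 : ℝ) ^ k := by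
      rw [← dist_eq_norm]
      exact (hu k n k hn le_rfl).le
    have h3 := Γ.ofReal_norm_sq (u n - u k)
    have h4 : Γ.sec (u n - u k) = Γ.sec (u n) - Γ.sec (u k) := rfl
    rw [h4] at h3
    refine h3.symm.le.trans (ENNReal.ofReal_le_ofReal ?_)
    calc ‖u n - u k‖ ^ 2 ≤ ((1 / 4 : ℝ) ^ k) ^ 2 := by gcongr
      _ = (1 / 16) ^ k := by rw [← pow_mul, mul_comm, pow_mul]; norm_num
  have hgmem : g ∈ Γ.sqInt := by
    have h1 : g - Γ.sec (u 0) ∈ Γ.sqInt := (hfatou 0).trans_lt (by simp)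
    simpa using Γ.sqInt.add_mem h1 (Γ.energy_sec_lt (u 0))
  refine ⟨Γ.toPre g hgmem, ?_⟩
  rw [tendsto_iff_dist_tendsto_zero]
  refine squeeze_zero (fun _ => dist_nonneg) (fun k => ?_)
    (tendsto_pow_atTop_nhds_zero_of_lt_one (r := (1 / 4 : ℝ)) (by norm_num) (by norm_num))
  rw [dist_comm, dist_eq_norm]
  have h1 := (Γ.ofReal_norm_sq (Γ.toPre g hgmem - u k)).trans_le (hfatou k)
  rw [ENNReal.ofReal_le_ofReal_iff (by positivity)] at h1
  have h2 : ((1 / 16 : ℝ)) ^ k = ((1 / 4 : ℝ) ^ k) ^ 2 := by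
    rw [← pow_mul, mul_comm, pow_mul]; norm_num
  rw [h2] at h1
  exact (sq_le_sq₀ (norm_nonneg _) (by positivity)).1 h1

variable {G : Type*} [Group G]

/-- The isometry of `L²` induced by a linear map of sections that preserves `∫ ‖f‖² dμ`. -/
def liftIsometry (T : F →ₗ[ℂ] F) (hT : ∀ f, Γ.energy (T f) = Γ.energy f) :
    Γ.L2 →ₗᵢ[ℂ] Γ.L2 :=
  let T₀ : Γ.PreL2 →ₗᵢ[ℂ] Γ.PreL2 :=
    { toFun := fun f => Γ.toPre (T (Γ.sec f)) ((hT (Γ.sec f)).trans_lt (Γ.energy_sec_lt f))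
      map_add' := fun f g => Subtype.ext (T.map_add (Γ.sec f) (Γ.sec g))
      map_smul' := fun c f => Subtype.ext (T.map_smul c (Γ.sec f))
      norm_map' := fun f => by
        have h := (Γ.ofReal_norm_sq (Γ.toPre (T (Γ.sec f)) ((hT (Γ.sec f)).trans_lt (Γ.energy_sec_lt f)))).trans
          ((hT (Γ.sec f)).trans (Γ.ofReal_norm_sq f).symm)
        rw [ENNReal.ofReal_eq_ofReal_iff (by positivity) (by positivity)] at h
        exact (sq_eq_sq₀ (norm_nonneg _) (norm_nonneg _)).1 h }
  { toLinearMap := (SeparationQuotient.liftCLM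
      ((SeparationQuotient.mkCLM ℂ Γ.PreL2).comp T₀.toContinuousLinearMap)
      (fun _ _ h => SeparationQuotient.mk_eq_mk.2 (h.map T₀.continuous))).toLinearMap
    norm_map' := fun f => by
      obtain ⟨f, rfl⟩ := SeparationQuotient.surjective_mk f
      exact (SeparationQuotient.norm_mk _).trans
        ((T₀.norm_map f).trans (SeparationQuotient.norm_mk _).symm) }

lemma liftIsometry_mk (T : F →ₗ[ℂ] F) (hT : ∀ f, Γ.energy (T f) = Γ.energy f) (f : Γ.PreL2) :
    Γ.liftIsometry T hT (SeparationQuotient.mk f)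
      = SeparationQuotient.mk (Γ.toPre (T (Γ.sec f)) ((hT (Γ.sec f)).trans_lt (Γ.energy_sec_lt f))) := rfl

/-- The unitary representation on `L²` induced by a linear action on sections that preserves
`∫ ‖f‖² dμ`: `g [f] = [ρ(g) f]`. -/
def unitaryRep (ρ : Representation ℂ G F) (hρ : ∀ g f, Γ.energy (ρ g f) = Γ.energy f) :
    G →* (Γ.L2 ≃ₗᵢ[ℂ] Γ.L2) where
  toFun g :=
    { toLinearEquiv := LinearEquiv.ofLinearMap (Γ.liftIsometry (ρ g) (hρ g)).toLinearMap
        (Γ.liftIsometry (ρ g⁻¹) (hρ g⁻¹)).toLinearMap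
        (by
          ext f
          obtain ⟨f, rfl⟩ := SeparationQuotient.surjective_mk f
          exact congrArg SeparationQuotient.mk (Γ.sec_injective (ρ.self_inv_apply g (Γ.sec f))))
        (by
          ext f
          obtain ⟨f, rfl⟩ := SeparationQuotient.surjective_mk f
          exact congrArg SeparationQuotient.mk (Γ.sec_injective (ρ.inv_self_apply g (Γ.sec f))))
      norm_map' := (Γ.liftIsometry (ρ g) (hρ g)).norm_map }
  map_one' := by
    ext f
    obtain ⟨f, rfl⟩ := SeparationQuotient.surjective_mk f
    exact congrArg SeparationQuotient.mk (Γ.sec_injective (by simp))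
  map_mul' g h := by
    ext f
    obtain ⟨f, rfl⟩ := SeparationQuotient.surjective_mk f
    exact congrArg SeparationQuotient.mk (Γ.sec_injective
      (LinearMap.congr_fun (map_mul ρ g h) (Γ.sec f)))

lemma unitaryRep_mk (ρ : Representation ℂ G F) (hρ : ∀ g f, Γ.energy (ρ g f) = Γ.energy f)
    (g : G) (f : Γ.PreL2) :
    Γ.unitaryRep ρ hρ g (SeparationQuotient.mk f)
      = SeparationQuotient.mk (Γ.toPre (ρ g (Γ.sec f)) ((hρ g (Γ.sec f)).trans_lt (Γ.energy_sec_lt f))) := rfl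

end SectionSpace

/-! ### Unitary representations, multiples, commutants -/

/-- The unitary representations of a group `G` on `H`. -/
abbrev UnitaryRep (G : Type*) [Group G] (H : Type*) [NormedAddCommGroup H]
    [InnerProductSpace ℂ H] := G →* (H ≃ₗᵢ[ℂ] H)

/-- The bounded operator `U(g)`. -/
def UnitaryRep.op {G : Type*} [Group G] {H : Type*} [NormedAddCommGroup H]
    [InnerProductSpace ℂ H] (U : UnitaryRep G H) (g : G) : H →L[ℂ] H :=
  (U g).toContinuousLinearEquiv.toContinuousLinearMap

/-- `U` is unitarily equivalent to a (finite or infinite) multiple of `W`, that is, to the Hilbert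
space direct sum of copies of `W` over some index set `ι`. -/
def UnitaryRep.IsMultipleOf {G : Type*} [Group G] {H K : Type*} [NormedAddCommGroup H]
    [InnerProductSpace ℂ H] [NormedAddCommGroup K] [InnerProductSpace ℂ K]
    (U : UnitaryRep G H) (W : UnitaryRep G K) : Prop :=
  ∃ (ι : Type) (V : H ≃ₗᵢ[ℂ] lp (fun _ : ι => K) 2),
    ∀ (g : G) (v : H) (i : ι), V (U g v) i = W g (V v i)

/-- The double commutant `S''` in `B(H)`. -/
def doubleCommutant {H : Type*} [NormedAddCommGroup H] [InnerProductSpace ℂ H]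
    (S : Set (H →L[ℂ] H)) : Set (H →L[ℂ] H) := Set.centralizer (Set.centralizer S)

/-! ### Direct integrals -/

/-- A measurable field of Hilbert spaces over `(X, μ)`: a linear space of vector fields, called the
measurable ones, that have measurable norm, that contains every vector field whose inner products
with measurable vector fields are measurable, and that contains a fundamental sequence. -/
structure MeasurableField {X : Type*} [MeasurableSpace X] (μ : Measure X) (E : X → Type*)
    [∀ x, NormedAddCommGroup (E x)] [∀ x, InnerProductSpace ℂ (E x)] where
  sections : Submodule ℂ (∀ x, E x)
  aemeasurable_norm : ∀ s ∈ sections, AEMeasurable (fun x => ‖s x‖) μ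
  mem_of_aemeasurable_inner : ∀ t : ∀ x, E x,
    (∀ s ∈ sections, AEMeasurable (fun x => (⟪s x, t x⟫_ℂ : ℂ)) μ) → t ∈ sections
  exists_fundamental_sequence : ∃ e : ℕ → ∀ x, E x, (∀ k, e k ∈ sections) ∧
    ∀ x, (Submodule.span ℂ (Set.range fun k => e k x)).topologicalClosure = ⊤

namespace MeasurableField

variable {X : Type*} [MeasurableSpace X] {μ : Measure X} {E : X → Type*}
  [∀ x, NormedAddCommGroup (E x)] [∀ x, InnerProductSpace ℂ (E x)]
  (𝓔 : MeasurableField μ E)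

/-- The measurable vector fields as a space of sections. -/
def sectionSpace : SectionSpace μ E 𝓔.sections where
  ev := 𝓔.sections.subtype
  aemeasurable_norm s := 𝓔.aemeasurable_norm s.1 s.2

/-- The direct integral Hilbert space `∫^⊕ E x dμ(x)`. -/
abbrev directIntegral : Type _ := 𝓔.sectionSpace.L2

instance [∀ x, CompleteSpace (E x)] : CompleteSpace 𝓔.directIntegral := by
  classical
  refine 𝓔.sectionSpace.completeSpace_L2 fun f hf => ?_
  set g : ∀ x, E x := fun x => limUnder atTop fun n => (f n).1 x with hg
  have hlim : ∀ᵐ x ∂μ, Tendsto (fun n => (f n).1 x) atTop (𝓝 (g x)) := by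
    filter_upwards [hf] with x hx
    exact hx.tendsto_limUnder
  refine ⟨⟨g, 𝓔.mem_of_aemeasurable_inner g fun s hs => ?_⟩, hlim⟩
  refine aemeasurable_of_tendsto_metrizable_ae (atTop : Filter ℕ)
    (fun n => 𝓔.sectionSpace.aemeasurable_inner ⟨s, hs⟩ (f n)) ?_
  filter_upwards [hlim] with x hx
  exact Tendsto.inner tendsto_const_nhds hx

variable {G : Type*} [Group G]

/-- A field of unitary representations is measurable if each `x ↦ U x g` is a measurable field of
operators, that is, maps measurable vector fields to measurable vector fields. -/
def IsMeasurableRep (U : ∀ x, UnitaryRep G (E x)) : Prop :=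
  ∀ g, ∀ s ∈ 𝓔.sections, (fun x => U x g (s x)) ∈ 𝓔.sections

/-- The direct integral `∫^⊕ U x dμ(x)` of a measurable field of unitary representations; it acts
by `g [s] = [x ↦ U x g (s x)]`. -/
def directIntegralRep (U : ∀ x, UnitaryRep G (E x)) (hU : 𝓔.IsMeasurableRep U) :
    UnitaryRep G 𝓔.directIntegral :=
  𝓔.sectionSpace.unitaryRep
    { toFun := fun g =>
        { toFun := fun s => ⟨fun x => U x g (s.1 x), hU g s.1 s.2⟩
          map_add' := fun s t => by ext x; simp
          map_smul' := fun c s => by ext x; simp }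
      map_one' := by ext s x; simp
      map_mul' := fun g h => by ext s x; simp }
    (fun g s => by simp [SectionSpace.energy, sectionSpace])

end MeasurableField

/-! ### Induced representations -/

section Induced

variable {G : Type*} [Group G] [MeasurableSpace G] {K : Subgroup G}

/-- The measurable functions `f : G → ℂ` with `f (g h) = σ(h)⁻¹ f(g)` for `h ∈ K`. -/
def equivariantFunctions (σ : K →* Circle) : Submodule ℂ (G → ℂ) where
  carrier := {f | Measurable f ∧ ∀ (g : G) (h : K), f (g * h) = (((σ h)⁻¹ : Circle) : ℂ) * f g}
  zero_mem' := ⟨measurable_zero, by simp⟩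
  add_mem' := by
    rintro f f' ⟨hf, hf'⟩ ⟨ht, ht'⟩
    exact ⟨hf.add ht, fun g h => by simp only [Pi.add_apply, hf', ht', mul_add]⟩
  smul_mem' := by
    rintro c f ⟨hf, hf'⟩
    exact ⟨hf.const_smul c, fun g h => by simp only [Pi.smul_apply, smul_eq_mul, hf']; ring⟩

lemma norm_equivariant_out {σ : K →* Circle} (f : equivariantFunctions σ) (g : G) :
    ‖f.1 ((QuotientGroup.mk g : G ⧸ K).out)‖ = ‖f.1 g‖ := by
  obtain ⟨h, hh⟩ := QuotientGroup.mk_out_eq_mul K g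
  rw [hh, f.2.2, norm_mul, Circle.norm_coe, one_mul]

lemma measurable_norm_out {σ : K →* Circle} (f : equivariantFunctions σ) :
    Measurable fun x : G ⧸ K => ‖f.1 x.out‖ := by
  refine QuotientGroup.measurable_from_quotient.2 ?_
  have h : (fun x : G ⧸ K => ‖f.1 x.out‖) ∘ (QuotientGroup.mk : G → G ⧸ K) = fun g => ‖f.1 g‖ :=
    funext fun g => norm_equivariant_out f g
  show Measurable ((fun x : G ⧸ K => ‖f.1 x.out‖) ∘ (QuotientGroup.mk : G → G ⧸ K))
  rw [h]
  exact f.2.1.norm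

/-- Equivariant functions as sections over `G ⧸ K`. The value at a coset is read off at a
representative; its absolute value and all inner products do not depend on the representative. -/
def inducedSections (σ : K →* Circle) (ν : Measure (G ⧸ K)) :
    SectionSpace ν (fun _ => ℂ) (equivariantFunctions σ) where
  ev :=
    { toFun := fun f x => f.1 x.out
      map_add' := fun _ _ => rfl
      map_smul' := fun _ _ => rfl }
  aemeasurable_norm f := (measurable_norm_out f).aemeasurable

/-- The Hilbert space of the induced representation: equivariant measurable functions on `G` with
`∫_{G/K} |f|² dν < ∞`, modulo functions that vanish almost everywhere. -/
abbrev InducedSpace (σ : K →* Circle) (ν : Measure (G ⧸ K)) : Type _ := (inducedSections σ ν).L2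

instance (σ : K →* Circle) (ν : Measure (G ⧸ K)) : CompleteSpace (InducedSpace σ ν) := by
  classical
  refine (inducedSections σ ν).completeSpace_L2 fun f hf => ?_
  set C : Set G := {x | ∃ c, Tendsto (fun n => (f n).1 x) atTop (𝓝 c)} with hC
  have hCm : MeasurableSet C := measurableSet_exists_tendsto fun n => (f n).2.1
  have hshift : ∀ (g : G) (h : K) (c : ℂ), Tendsto (fun n => (f n).1 g) atTop (𝓝 c) →
      Tendsto (fun n => (f n).1 (g * h)) atTop (𝓝 ((((σ h)⁻¹ : Circle) : ℂ) * c)) := by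
    intro g h c hc
    refine (hc.const_mul (((σ h)⁻¹ : Circle) : ℂ)).congr fun n => ?_
    exact ((f n).2.2 g h).symm
  have hCK : ∀ (g : G) (h : K), g * h ∈ C ↔ g ∈ C := by
    refine fun g h => ⟨fun ⟨c, hc⟩ => ?_, fun ⟨c, hc⟩ => ⟨_, hshift g h c hc⟩⟩
    have := hshift (g * h) h⁻¹ c hc
    simp only [mul_assoc, InvMemClass.coe_inv, mul_inv_cancel, mul_one] at this
    exact ⟨_, this⟩
  set F : G → ℂ := fun x => if x ∈ C then limUnder atTop (fun n => (f n).1 x) else 0 with hF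
  have hFlim : ∀ x ∈ C, Tendsto (fun n => (f n).1 x) atTop (𝓝 (F x)) := by
    intro x hx
    simp only [hF, if_pos hx]
    exact tendsto_nhds_limUnder hx
  have hFm : Measurable F := by
    refine measurable_of_tendsto_metrizable (f := fun n => C.indicator (f n).1)
      (fun n => (f n).2.1.indicator hCm) (tendsto_pi_nhds.2 fun x => ?_)
    by_cases hx : x ∈ C
    · simpa [Set.indicator_of_mem hx] using hFlim x hx
    · simp [hF, hx]
  refine ⟨⟨F, hFm, fun g h => ?_⟩, ?_⟩
  · by_cases hg : g ∈ C
    · exact tendsto_nhds_unique (hFlim _ ((hCK g h).2 hg)) (hshift g h _ (hFlim g hg))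
    · simp [hF, hg, hCK]
  · filter_upwards [hf] with x hx
    exact hFlim _ (cauchySeq_tendsto_of_complete hx)

/-- The unitary representation of `G` induced from the unitary character `σ` of the subgroup `K`,
with respect to a `G`-invariant measure `ν` on `G ⧸ K`; it acts by left translation. -/
def inducedRep [MeasurableConstSMul G G] (σ : K →* Circle) (ν : Measure (G ⧸ K))
    (hν : ∀ g : G, MeasurePreserving (fun x : G ⧸ K => g • x) ν ν) :
    UnitaryRep G (InducedSpace σ ν) :=
  (inducedSections σ ν).unitaryRep
    { toFun := fun g =>
        { toFun := fun f => ⟨fun x => f.1 (g⁻¹ * x), f.2.1.comp (measurable_const_smul g⁻¹),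
            fun x h => (congrArg f.1 (mul_assoc g⁻¹ x h).symm).trans (f.2.2 (g⁻¹ * x) h)⟩
          map_add' := fun _ _ => rfl
          map_smul' := fun _ _ => rfl }
      map_one' := by ext f x; simp
      map_mul' := fun g h => by ext f x; simp [mul_assoc] }
    (fun g f => by
      have hm : Measurable (fun x : G ⧸ K => ENNReal.ofReal (‖f.1 x.out‖ ^ 2)) :=
        ((measurable_norm_out f).pow_const 2).ennreal_ofReal
      refine Eq.trans (lintegral_congr fun x => ?_) ((hν g⁻¹).lintegral_comp hm)
      obtain ⟨y, rfl⟩ := QuotientGroup.mk_surjective x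
      have h1 : (g⁻¹ • (QuotientGroup.mk y : G ⧸ K)) = QuotientGroup.mk (g⁻¹ * y) := rfl
      obtain ⟨h, hh⟩ := QuotientGroup.mk_out_eq_mul K y
      show ENNReal.ofReal (‖f.1 (g⁻¹ * (QuotientGroup.mk y : G ⧸ K).out)‖ ^ 2)
        = ENNReal.ofReal (‖f.1 (g⁻¹ • (QuotientGroup.mk y : G ⧸ K)).out‖ ^ 2)
      rw [h1, norm_equivariant_out f, hh, ← mul_assoc, f.2.2, norm_mul, Circle.norm_coe, one_mul])

end Induced

/-! ### The Poincaré group and the subgroups attached to wedges -/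

/-- Minkowski space `ℝ^{1+3}`, with coordinates `x 0, x 1, x 2, x 3`. -/
abbrev Minkowski : Type := Fin 4 → ℝ

/-- The Minkowski product with signature `(+,-,-,-)`. -/
def minkowskiProd (p x : Minkowski) : ℝ := p 0 * x 0 - p 1 * x 1 - p 2 * x 2 - p 3 * x 3

abbrev SL2C : Type := Matrix.SpecialLinearGroup (Fin 2) ℂ

/-- The Hermitian matrix `x₀ 1 + ∑ xᵢ σᵢ`. -/
def toHerm (x : Minkowski) : Matrix (Fin 2) (Fin 2) ℂ :=
  !![(x 0 : ℂ) + x 3, x 1 - Complex.I * x 2; x 1 + Complex.I * x 2, x 0 - x 3]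

/-- The vector `x` with `toHerm x = M`, for a Hermitian matrix `M`. -/
def ofHerm (M : Matrix (Fin 2) (Fin 2) ℂ) : Minkowski :=
  ![(M 0 0 + M 1 1).re / 2, (M 1 0).re, (M 1 0).im, (M 0 0 - M 1 1).re / 2]

/-- The Lorentz transformation `Λ(A)`, with `toHerm (Λ(A) x) = A (toHerm x) A*`. -/
def lorentz (A : SL2C) (x : Minkowski) : Minkowski :=
  ofHerm (A.1 * toHerm x * A.1.conjTranspose)

lemma ofHerm_toHerm (x : Minkowski) : ofHerm (toHerm x) = x := by
  ext i
  fin_cases i <;> simp [ofHerm, toHerm]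

lemma toHerm_ofHerm {M : Matrix (Fin 2) (Fin 2) ℂ} (hM : M.IsHermitian) :
    toHerm (ofHerm M) = M := by
  have h00 := congrFun (congrFun hM 0) 0
  have h01 := congrFun (congrFun hM 0) 1
  have h11 := congrFun (congrFun hM 1) 1
  simp only [Matrix.conjTranspose_apply, Complex.ext_iff, Complex.star_def, Complex.conj_re,
    Complex.conj_im] at h00 h01 h11
  ext i j
  fin_cases i <;> fin_cases j <;> apply Complex.ext <;> simp [ofHerm, toHerm] <;> linarith

lemma isHermitian_toHerm (x : Minkowski) : (toHerm x).IsHermitian := by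
  ext i j
  fin_cases i <;> fin_cases j <;> simp [toHerm]; ring

lemma toHerm_lorentz (A : SL2C) (x : Minkowski) :
    toHerm (lorentz A x) = A.1 * toHerm x * A.1.conjTranspose :=
  toHerm_ofHerm (Matrix.isHermitian_mul_mul_conjTranspose A.1 (isHermitian_toHerm x))

lemma toHerm_injective : Function.Injective toHerm :=
  Function.LeftInverse.injective ofHerm_toHerm

lemma toHerm_add (x y : Minkowski) : toHerm (x + y) = toHerm x + toHerm y := by
  ext i j
  fin_cases i <;> fin_cases j <;> simp [toHerm] <;> ring

lemma lorentz_add (A : SL2C) (x y : Minkowski) :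
    lorentz A (x + y) = lorentz A x + lorentz A y := by
  apply toHerm_injective
  simp only [toHerm_lorentz, toHerm_add, Matrix.mul_add, Matrix.add_mul]

lemma lorentz_one (x : Minkowski) : lorentz 1 x = x := by
  apply toHerm_injective
  simp [toHerm_lorentz]

lemma lorentz_mul (A B : SL2C) (x : Minkowski) :
    lorentz (A * B) x = lorentz A (lorentz B x) := by
  apply toHerm_injective
  simp [toHerm_lorentz, Matrix.mul_assoc]

/-- The action of `SL(2,ℂ)` on the translation group by automorphisms. -/
def lorentzHom : SL2C →* MulAut (Multiplicative Minkowski) where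
  toFun A :=
    { toFun := fun x => Multiplicative.ofAdd (lorentz A x.toAdd)
      invFun := fun x => Multiplicative.ofAdd (lorentz A⁻¹ x.toAdd)
      left_inv := fun x => by simp [← lorentz_mul, lorentz_one]
      right_inv := fun x => by simp [← lorentz_mul, lorentz_one]
      map_mul' := fun x y => by simp [lorentz_add] }
  map_one' := by ext x; simp [lorentz_one]
  map_mul' A B := by ext x; simp [lorentz_mul]

/-- The universal cover `ℝ^{1+3} ⋊ SL(2,ℂ)` of the Poincaré group. -/
abbrev Poincare : Type := Multiplicative Minkowski ⋊[lorentzHom] SL2C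

/-- The product topology. -/
instance : TopologicalSpace Poincare :=
  TopologicalSpace.induced (fun g => ((g.left.toAdd, g.right) : Minkowski × SL2C)) inferInstance

instance : MeasurableSpace Poincare := borel Poincare
instance : BorelSpace Poincare := ⟨rfl⟩

/-- The action of the Poincaré group on Minkowski space. -/
def act (g : Poincare) (x : Minkowski) : Minkowski := g.left.toAdd + lorentz g.right x

/-- The wedge `W₃ = {|x₀| < x₃}`. -/
def wedge3 : Set Minkowski := {x | |x 0| < x 3}

/-- The spacelike complement `S'` (an open region). -/
def spacelikeComplement (S : Set Minkowski) : Set Minkowski :=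
  interior {x | ∀ y ∈ S, minkowskiProd (x - y) (x - y) < 0}

/-- `G₃⁰ = {A ∈ SL(2,ℂ) : Λ(A) W₃ = W₃}`. -/
def G30 : Subgroup SL2C where
  carrier := {A | lorentz A '' wedge3 = wedge3}
  one_mem' := by simp [lorentz_one]
  mul_mem' := by
    intro A B hA hB
    show lorentz (A * B) '' wedge3 = wedge3
    have h : lorentz (A * B) = lorentz A ∘ lorentz B := funext (lorentz_mul A B)
    rw [h, Set.image_comp, hB, hA]
  inv_mem' := by
    intro A hA
    show lorentz A⁻¹ '' wedge3 = wedge3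
    conv_lhs => rw [← hA]
    rw [← Set.image_comp]
    have h : lorentz A⁻¹ ∘ lorentz A = id := by
      funext x
      simp [← lorentz_mul, lorentz_one]
    rw [h, Set.image_id]

/-- `r₁(π) = exp(i (π/2) σ₁)`. -/
def r1Pi : SL2C := ⟨!![0, Complex.I; Complex.I, 0], by simp [Matrix.det_fin_two]⟩

/-- `G̃₃⁰ = ⟨G₃⁰, r₁(π)⟩`. -/
def Gt30 : Subgroup SL2C := G30 ⊔ Subgroup.zpowers r1Pi

/-- `G₃ = ℝ^{1+3} ⋊ G₃⁰`. -/
def G3 : Subgroup Poincare := G30.comap SemidirectProduct.rightHom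

/-- `G̃₃ = ℝ^{1+3} ⋊ G̃₃⁰`. -/
def Gt3 : Subgroup Poincare := Gt30.comap SemidirectProduct.rightHom

/-- The wedge `W = g W₃`; every wedge is of this form. -/
def wedge (g : Poincare) : Set Minkowski := act g '' wedge3

/-- `G_W = g G₃ g⁻¹` for `W = g W₃`. -/
def GW (g : Poincare) : Subgroup Poincare := G3.map (MulAut.conj g).toMonoidHom

/-- `G̃_W = g G̃₃ g⁻¹` for `W = g W₃`. -/
def GtW (g : Poincare) : Subgroup Poincare := Gt3.map (MulAut.conj g).toMonoidHom

/-! ### The massless representations `W_{r,n}` -/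

/-- `λ₃(t) r₃(θ) = exp((t + iθ) σ₃ / 2)`. -/
def boostRot (t θ : ℝ) : SL2C :=
  ⟨!![Complex.exp ((t + θ * Complex.I) / 2), 0; 0, Complex.exp (-((t + θ * Complex.I) / 2))], by
    rw [Matrix.det_fin_two_of, ← Complex.exp_add]
    simp⟩

lemma boostRot_val (t θ : ℝ) : (boostRot t θ).1 =
    !![Complex.exp ((t + θ * Complex.I) / 2), 0; 0, Complex.exp (-((t + θ * Complex.I) / 2))] :=
  rfl

lemma r1Pi_val : r1Pi.1 = !![0, Complex.I; Complex.I, 0] := rfl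

/-- An element of `SL(2,ℂ)` that preserves `W₃` is diagonal. -/
lemma diag_of_mem_G30 {A : SL2C} (hA : A ∈ G30) : A.1 0 1 = 0 ∧ A.1 1 0 = 0 := by
  have hdet : A.1 0 0 * A.1 1 1 - A.1 0 1 * A.1 1 0 = 1 := by
    rw [← Matrix.det_fin_two]; exact A.2
  have key : ∀ x ∈ wedge3, lorentz A x ∈ wedge3 := fun x hx => by
    have h : lorentz A '' wedge3 = wedge3 := hA
    rw [← h]
    exact Set.mem_image_of_mem _ hx
  -- the two inequalities that describe membership of the image in the wedge
  have key2 : ∀ u v : ℝ,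
      0 < Complex.normSq (A.1 0 0) - Complex.normSq (A.1 0 1)
        + 2 * (u * (A.1 0 0 * star (A.1 0 1)).re + v * (A.1 0 0 * star (A.1 0 1)).im) ∧
      0 < Complex.normSq (A.1 1 1) - Complex.normSq (A.1 1 0)
        - 2 * (u * (A.1 1 0 * star (A.1 1 1)).re + v * (A.1 1 0 * star (A.1 1 1)).im) := by
    intro u v
    have h := key ![0, u, v, 1] (by simp [wedge3])
    simp only [wedge3, Set.mem_ofPred_eq, abs_lt] at h
    simp [lorentz, ofHerm, toHerm, Matrix.mul_apply, Fin.sum_univ_two] at h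
    simp [Complex.normSq_apply]
    constructor <;> nlinarith [h.1, h.2]
  have hz : ∀ c z1 z2 : ℝ, (∀ u v : ℝ, 0 < c + 2 * (u * z1 + v * z2)) → z1 = 0 ∧ z2 = 0 := by
    intro c z1 z2 h
    constructor
    · by_contra hne
      have := h (-(c / (2 * z1))) 0
      field_simp at this
      simp at this
    · by_contra hne
      have := h 0 (-(c / (2 * z2)))
      field_simp at this
      simp at this
  have h1 := hz _ _ _ fun u v => (key2 u v).1
  have h2 := hz _ _ _ fun u v => by
    have := (key2 (-u) (-v)).2
    have e : ∀ a b z1 z2 : ℝ, a - b - 2 * (-u * z1 + -v * z2) = (a - b) + 2 * (u * z1 + v * z2) := by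
      intros; ring
    rwa [e] at this
  have p1 : A.1 0 0 * star (A.1 0 1) = 0 := Complex.ext h1.1 h1.2
  have p2 : A.1 1 0 * star (A.1 1 1) = 0 := Complex.ext h2.1 h2.2
  have pos := key2 0 0
  rcases mul_eq_zero.1 p1 with h | h
  · exfalso
    have := pos.1
    simp [h] at this
    linarith [Complex.normSq_nonneg (A.1 0 1)]
  · have h01 : A.1 0 1 = 0 := by simpa using h
    refine ⟨h01, ?_⟩
    rcases mul_eq_zero.1 p2 with h' | h'
    · exact h'
    · exfalso
      have h11 : A.1 1 1 = 0 := by simpa using h'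
      simp [h01, h11] at hdet

lemma boostRot_of_diag {A : SL2C} (h : A.1 0 1 = 0 ∧ A.1 1 0 = 0) :
    ∃ t θ : ℝ, A = boostRot t θ := by
  have hdet : A.1 0 0 * A.1 1 1 = 1 := by
    have := A.2
    rw [Matrix.det_fin_two, h.1, h.2] at this
    simpa using this
  have hne : A.1 0 0 ≠ 0 := left_ne_zero_of_mul_eq_one hdet
  set w := Complex.log (A.1 0 0) with hw
  refine ⟨2 * w.re, 2 * w.im, ?_⟩
  have he : (((2 * w.re : ℝ) : ℂ) + ((2 * w.im : ℝ) : ℂ) * Complex.I) / 2 = w := by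
    apply Complex.ext <;> simp
  have hexp : Complex.exp w = A.1 0 0 := Complex.exp_log hne
  apply Subtype.ext
  ext i j
  fin_cases i <;> fin_cases j
  · simp only [boostRot, he]; simp [hexp]
  · simp [boostRot, h.1]
  · simp [boostRot, h.2]
  · simp only [boostRot, he]
    simp [Complex.exp_neg, hexp]
    exact eq_inv_of_mul_eq_one_right hdet

lemma boostRot_mul (t θ s α : ℝ) :
    boostRot s α * boostRot t θ = boostRot (t + s) (θ + α) := by
  apply Subtype.ext
  show (boostRot s α).1 * (boostRot t θ).1 = (boostRot (t + s) (θ + α)).1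
  rw [boostRot_val, boostRot_val, boostRot_val]
  ext i j
  fin_cases i <;> fin_cases j <;>
    simp [Matrix.mul_apply, Fin.sum_univ_two, ← Complex.exp_add] <;> ring_nf

lemma boostRot_mem (t θ : ℝ) : boostRot t θ ∈ G30 := by
  have key : ∀ t θ : ℝ, ∀ x ∈ wedge3, lorentz (boostRot t θ) x ∈ wedge3 := by
    intro t θ x hx
    have hx' := abs_lt.1 (show |x 0| < x 3 from hx)
    have e1 : toHerm (lorentz (boostRot t θ) x) 0 0 = Real.exp t * (x 0 + x 3 : ℝ) := by
      rw [toHerm_lorentz]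
      simp [boostRot, toHerm, Matrix.mul_apply, Fin.sum_univ_two, ← Complex.exp_conj]
      rw [mul_right_comm, ← Complex.exp_add, show (starRingEnd ℂ) 2 = 2 from Complex.conj_ofReal 2]
      congr 2
      ring
    have e2 : toHerm (lorentz (boostRot t θ) x) 1 1 = Real.exp (-t) * (x 0 - x 3 : ℝ) := by
      rw [toHerm_lorentz]
      simp [boostRot, toHerm, Matrix.mul_apply, Fin.sum_univ_two, ← Complex.exp_conj]
      rw [mul_right_comm, ← Complex.exp_add, show (starRingEnd ℂ) 2 = 2 from Complex.conj_ofReal 2]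
      congr 2
      ring
    set y := lorentz (boostRot t θ) x
    have f1 : y 0 + y 3 = Real.exp t * (x 0 + x 3) := by
      have := e1
      simp only [toHerm, Matrix.of_apply, Matrix.cons_val', Matrix.cons_val_zero] at this
      exact_mod_cast this
    have f2 : y 0 - y 3 = Real.exp (-t) * (x 0 - x 3) := by
      have : (y 0 : ℂ) - y 3 = _ := e2
      exact_mod_cast this
    show |y 0| < y 3
    have p1 := mul_pos (Real.exp_pos t) (show 0 < x 0 + x 3 by linarith)
    have p2 := mul_pos (Real.exp_pos (-t)) (show 0 < x 3 - x 0 by linarith)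
    rw [abs_lt]
    constructor <;> nlinarith
  show lorentz (boostRot t θ) '' wedge3 = wedge3
  refine Set.Subset.antisymm (Set.image_subset_iff.2 (key t θ)) fun x hx => ?_
  refine ⟨_, key (-t) (-θ) x hx, ?_⟩
  rw [← lorentz_mul, boostRot_mul]
  have : boostRot (-t + t) (-θ + θ) = 1 := by
    apply Subtype.ext
    ext i j
    fin_cases i <;> fin_cases j <;> simp [boostRot]
  rw [this, lorentz_one]

lemma r1Pi_mul_boostRot (t θ : ℝ) : r1Pi * boostRot t θ = boostRot (-t) (-θ) * r1Pi := by
  apply Subtype.ext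
  show r1Pi.1 * (boostRot t θ).1 = (boostRot (-t) (-θ)).1 * r1Pi.1
  rw [boostRot_val, boostRot_val, r1Pi_val]
  ext i j
  fin_cases i <;> fin_cases j <;> simp [Matrix.mul_apply, Fin.sum_univ_two] <;> ring_nf

/-- Every element of `G̃₃⁰` is of the form `λ₃(t) r₃(θ)` or `λ₃(t) r₃(θ) r₁(π)`. -/
lemma exists_of_mem_Gt30 {A : SL2C} (hA : A ∈ Gt30) :
    (∃ t θ : ℝ, A = boostRot t θ) ∨ ∃ t θ : ℝ, A = boostRot t θ * r1Pi := by
  let D : Subgroup SL2C :=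
    { carrier := {A | (A.1 0 1 = 0 ∧ A.1 1 0 = 0) ∨ (A.1 0 0 = 0 ∧ A.1 1 1 = 0)}
      one_mem' := Or.inl ⟨by simp, by simp⟩
      mul_mem' := by
        intro A B hA hB
        have e : (A * B).1 = A.1 * B.1 := rfl
        simp only [Set.mem_ofPred_eq, e, Matrix.mul_apply, Fin.sum_univ_two]
        rcases hA with ⟨h1, h2⟩ | ⟨h1, h2⟩ <;> rcases hB with ⟨h3, h4⟩ | ⟨h3, h4⟩ <;>
          simp [h1, h2, h3, h4]
      inv_mem' := by
        intro A hA
        have e : (A⁻¹).1 = A.1.adjugate := rfl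
        simp only [Set.mem_ofPred_eq, e, Matrix.adjugate_fin_two]
        rcases hA with ⟨h1, h2⟩ | ⟨h1, h2⟩ <;> simp [h1, h2] }
  have hle : Gt30 ≤ D := by
    refine sup_le (fun A hA => Or.inl (diag_of_mem_G30 hA)) ?_
    rw [Subgroup.zpowers_le]
    exact Or.inr ⟨by simp [r1Pi_val], by simp [r1Pi_val]⟩
  rcases hle hA with h | h
  · exact Or.inl (boostRot_of_diag h)
  · right
    have h' : (A * r1Pi⁻¹).1 0 1 = 0 ∧ (A * r1Pi⁻¹).1 1 0 = 0 := by
      have e : (A * r1Pi⁻¹).1 = A.1 * r1Pi.1.adjugate := rfl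
      rw [e, r1Pi_val, Matrix.adjugate_fin_two]
      simp [Matrix.mul_apply, Fin.sum_univ_two, h.1, h.2]
    obtain ⟨t, θ, e⟩ := boostRot_of_diag h'
    exact ⟨t, θ, by rw [← e, inv_mul_cancel_right]⟩

lemma r1Pi_sq_mul_boostRot (t θ : ℝ) :
    boostRot t (θ + 2 * Real.pi) = boostRot t θ * r1Pi ^ 2 := by
  rw [pow_two]
  apply Subtype.ext
  show (boostRot t (θ + 2 * Real.pi)).1 = (boostRot t θ).1 * (r1Pi.1 * r1Pi.1)
  rw [boostRot_val, boostRot_val, r1Pi_val]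
  have h1 : ((t : ℂ) + ((θ + 2 * Real.pi : ℝ) : ℂ) * Complex.I) / 2
      = (t + θ * Complex.I) / 2 + Real.pi * Complex.I := by
    push_cast; ring
  rw [h1, neg_add, Complex.exp_add, Complex.exp_add, Complex.exp_neg (Real.pi * Complex.I),
    Complex.exp_pi_mul_I]
  ext i j
  fin_cases i <;> fin_cases j <;> simp [Matrix.mul_apply, Fin.sum_univ_two]

/-- The subgroup `ℝ^{1+3} ⋊ ⟨r₁(π)⟩` of `G̃₃`, the stabilizer of `q_r = (r, r, 0, 0)`. -/
def stab : Subgroup Gt3 :=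
  ((Subgroup.zpowers r1Pi).comap SemidirectProduct.rightHom).subgroupOf Gt3

/-- `q_r = (r, r, 0, 0)`. -/
def qPoint (r : ℝ) : Minkowski := ![r, r, 0, 0]

/-- The translation character `χ_p(x) = exp(i p·x)`. -/
def translationChar (p x : Minkowski) : Circle := Circle.exp (minkowskiProd p x)

lemma zpowers_r1Pi {A : SL2C} (hA : A ∈ Subgroup.zpowers r1Pi) :
    (A.1 1 1 = A.1 0 0 ∧ A.1 1 0 = A.1 0 1 ∧ ‖A.1 0 0 + A.1 0 1‖ = 1) ∧
      ∀ r x, minkowskiProd (qPoint r) (lorentz A x) = minkowskiProd (qPoint r) x := by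
  let S : Subgroup SL2C :=
    { carrier := {A | (A.1 1 1 = A.1 0 0 ∧ A.1 1 0 = A.1 0 1 ∧ ‖A.1 0 0 + A.1 0 1‖ = 1) ∧
        ∀ r x, minkowskiProd (qPoint r) (lorentz A x) = minkowskiProd (qPoint r) x}
      one_mem' := by simp [lorentz_one]
      mul_mem' := by
        rintro A B ⟨⟨a1, a2, a3⟩, a4⟩ ⟨⟨b1, b2, b3⟩, b4⟩
        have e : (A * B).1 = A.1 * B.1 := rfl
        refine ⟨⟨?_, ?_, ?_⟩, fun r x => by rw [lorentz_mul, a4, b4]⟩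
        · simp only [e, Matrix.mul_apply, Fin.sum_univ_two, a1, a2, b1, b2]; ring
        · simp only [e, Matrix.mul_apply, Fin.sum_univ_two, a1, a2, b1, b2]; ring
        · have : (A * B).1 0 0 + (A * B).1 0 1
              = (A.1 0 0 + A.1 0 1) * (B.1 0 0 + B.1 0 1) := by
            simp only [e, Matrix.mul_apply, Fin.sum_univ_two, b1, b2]; ring
          rw [this, norm_mul, a3, b3, one_mul]
      inv_mem' := by
        rintro A ⟨⟨a1, a2, a3⟩, a4⟩
        have e : (A⁻¹).1 = A.1.adjugate := rfl
        have hdet := A.2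
        rw [Matrix.det_fin_two, a1, a2] at hdet
        refine ⟨⟨?_, ?_, ?_⟩, fun r x => ?_⟩
        · simp [e, Matrix.adjugate_fin_two, a1]
        · simp [e, Matrix.adjugate_fin_two, a2]
        · have h1 : ((A⁻¹).1 0 0 + (A⁻¹).1 0 1) * (A.1 0 0 + A.1 0 1) = 1 := by
            simp only [e, Matrix.adjugate_fin_two]
            simp [a1]
            linear_combination hdet
          have h2 := congrArg norm h1
          rwa [norm_mul, a3, mul_one, norm_one] at h2
        · rw [← a4, ← lorentz_mul, mul_inv_cancel, lorentz_one] }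
  have hle : Subgroup.zpowers r1Pi ≤ S := by
    rw [Subgroup.zpowers_le]
    refine ⟨by simp [r1Pi_val], fun r x => ?_⟩
    simp [minkowskiProd, qPoint, lorentz, ofHerm, toHerm, r1Pi_val, Matrix.mul_apply,
      Fin.sum_univ_two]
  exact hle hA

/-- The first-row sum of an element of `⟨r₁(π)⟩`. As `r₁(π)` multiplies the vector `(1, 1)` by `i`,
this is `i ^ k` for `r₁(π) ^ k`, so it is the character `V₁`. -/
def rowSum (A : Subgroup.zpowers r1Pi) : Circle :=
  ⟨A.1.1 0 0 + A.1.1 0 1, mem_sphere_zero_iff_norm.2 (zpowers_r1Pi A.2).1.2.2⟩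

/-- The character `V_n` of `⟨r₁(π)⟩ ≅ ℤ/4`, with `V_n(r₁(π)) = i ^ n`. -/
def littleChar (n : Fin 4) : Subgroup.zpowers r1Pi →* Circle where
  toFun A := rowSum A ^ (n : ℕ)
  map_one' := by
    have : rowSum 1 = 1 := by
      apply Circle.ext
      show (1 : SL2C).1 0 0 + (1 : SL2C).1 0 1 = 1
      simp
    rw [this, one_pow]
  map_mul' A B := by
    have : rowSum (A * B) = rowSum A * rowSum B := by
      apply Circle.ext
      show (A.1.1 * B.1.1) 0 0 + (A.1.1 * B.1.1) 0 1
        = (A.1.1 0 0 + A.1.1 0 1) * (B.1.1 0 0 + B.1.1 0 1)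
      have h := (zpowers_r1Pi B.2).1
      simp only [Matrix.mul_apply, Fin.sum_univ_two, h.1, h.2.1]
      ring
    rw [this, mul_pow]

lemma littleChar_r1Pi (n : Fin 4) :
    (littleChar n ⟨r1Pi, Subgroup.mem_zpowers r1Pi⟩ : ℂ) = Complex.I ^ (n : ℕ) := by
  have : ((rowSum ⟨r1Pi, Subgroup.mem_zpowers r1Pi⟩ : Circle) : ℂ) = Complex.I := by
    show r1Pi.1 0 0 + r1Pi.1 0 1 = Complex.I
    simp [r1Pi_val]
  show ((rowSum _ ^ (n : ℕ) : Circle) : ℂ) = _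
  rw [Circle.coe_pow, this]

/-- The character `χ_{q_r} · V_n` of `ℝ^{1+3} ⋊ ⟨r₁(π)⟩`: `(x, A) ↦ χ_{q_r}(x) V_n(A)`. -/
def stabChar (r : ℝ) (n : Fin 4) : stab →* Circle where
  toFun h := translationChar (qPoint r) h.1.1.left.toAdd * littleChar n ⟨h.1.1.right, h.2⟩
  map_one' := by
    have : littleChar n ⟨(1 : stab).1.1.right, (1 : stab).2⟩ = 1 := (littleChar n).map_one
    rw [this]
    simp [translationChar, minkowskiProd]
  map_mul' h k := by
    have h1 : littleChar n ⟨(h * k).1.1.right, (h * k).2⟩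
        = littleChar n ⟨h.1.1.right, h.2⟩ * littleChar n ⟨k.1.1.right, k.2⟩ :=
      (littleChar n).map_mul ⟨h.1.1.right, h.2⟩ ⟨k.1.1.right, k.2⟩
    have h2 : (h * k).1.1.left.toAdd
        = h.1.1.left.toAdd + lorentz h.1.1.right k.1.1.left.toAdd := rfl
    have h3 : translationChar (qPoint r) (h * k).1.1.left.toAdd
        = translationChar (qPoint r) h.1.1.left.toAdd
          * translationChar (qPoint r) k.1.1.left.toAdd := by
      have h4 : ∀ x y, minkowskiProd (qPoint r) (x + y)
          = minkowskiProd (qPoint r) x + minkowskiProd (qPoint r) y := by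
        intro x y
        simp only [minkowskiProd, Pi.add_apply]
        ring
      rw [h2]
      unfold translationChar
      have h5 : minkowskiProd (qPoint r) (lorentz h.1.1.right k.1.1.left.toAdd)
          = minkowskiProd (qPoint r) k.1.1.left.toAdd := (zpowers_r1Pi h.2).2 _ _
      rw [h4, h5, Circle.exp_add]
    rw [h1, h3, mul_mul_mul_comm]

/-- `λ₃(t) r₃(θ)` as an element of `G̃₃`. -/
def boostRotG (t θ : ℝ) : Gt3 :=
  ⟨SemidirectProduct.inr (boostRot t θ), Subgroup.mem_sup_left (boostRot_mem t θ)⟩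

/-- The `G̃₃`-invariant measure `dt dθ` on `G̃₃ / (ℝ^{1+3} ⋊ ⟨r₁(π)⟩)`, where the coset of
`λ₃(t) r₃(θ)` has the coordinates `t ∈ ℝ` and `θ ∈ (0, 2π]`. -/
def orbitMeasure : Measure (Gt3 ⧸ stab) :=
  Measure.map (fun p : ℝ × ℝ => (QuotientGroup.mk (boostRotG p.1 p.2) : Gt3 ⧸ stab))
    ((volume : Measure ℝ).prod (volume.restrict (Set.Ioc 0 (2 * Real.pi))))

lemma continuous_lorentz (A : SL2C) : Continuous (lorentz A) := by
  refine continuous_pi fun i => ?_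
  fin_cases i <;> simp [lorentz, ofHerm, toHerm, Matrix.mul_apply, Fin.sum_univ_two] <;> fun_prop

lemma continuous_poincare_iff {Y : Type*} [TopologicalSpace Y] {f : Y → Poincare} :
    Continuous f ↔ Continuous fun y => (((f y).left.toAdd, (f y).right) : Minkowski × SL2C) :=
  continuous_induced_rng

lemma continuous_poincare_mul_left (g : Poincare) : Continuous fun x : Poincare => g * x := by
  rw [continuous_poincare_iff]
  have h := continuous_poincare_iff.1 (continuous_id (X := Poincare))
  refine Continuous.prodMk ?_ ?_
  · exact continuous_const.add ((continuous_lorentz g.right).comp h.fst)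
  · exact continuous_const.mul h.snd

instance : MeasurableConstSMul Gt3 Gt3 where
  measurable_const_smul g := by
    refine Continuous.measurable (Continuous.subtype_mk ?_ _)
    exact (continuous_poincare_mul_left g.1).comp continuous_subtype_val

lemma measurable_smul_coset (g : Gt3) : Measurable fun x : Gt3 ⧸ stab => g • x := by
  refine QuotientGroup.measurable_from_quotient.2 ?_
  exact QuotientGroup.measurable_coe.comp (measurable_const_smul g)

/-- The coset of `λ₃(t) r₃(θ)`. -/
def coset (t θ : ℝ) : Gt3 ⧸ stab := QuotientGroup.mk (boostRotG t θ)

lemma measurable_coset : Measurable fun p : ℝ × ℝ => coset p.1 p.2 := by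
  refine QuotientGroup.measurable_coe.comp (Continuous.measurable (Continuous.subtype_mk ?_ _))
  rw [continuous_poincare_iff]
  refine Continuous.prodMk continuous_const (Continuous.subtype_mk ?_ _)
  refine continuous_matrix fun i j => ?_
  fin_cases i <;> fin_cases j <;> simp <;> fun_prop

/-- Cosets in `G̃₃` depend on the homogeneous part up to right multiplication by `⟨r₁(π)⟩` only. -/
lemma mk_eq_coset (x : Gt3) (t θ : ℝ) (B : SL2C) (hB : B ∈ Subgroup.zpowers r1Pi)
    (h : x.1.right = boostRot t θ * B) : (QuotientGroup.mk x : Gt3 ⧸ stab) = coset t θ := by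
  refine (QuotientGroup.eq.2 ?_).symm
  show (boostRot t θ)⁻¹ * x.1.right ∈ Subgroup.zpowers r1Pi
  rw [h, inv_mul_cancel_left]
  exact hB

lemma coset_periodic (t : ℝ) : Function.Periodic (coset t) (2 * Real.pi) := fun θ =>
  mk_eq_coset _ _ _ (r1Pi ^ 2) (Subgroup.pow_mem _ (Subgroup.mem_zpowers _) 2)
    (r1Pi_sq_mul_boostRot t θ)

lemma smul_coset (g : Gt3) : ∃ s α : ℝ, (∀ t θ, g • coset t θ = coset (t + s) (θ + α)) ∨
    ∀ t θ, g • coset t θ = coset (-t + s) (-θ + α) := by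
  rcases exists_of_mem_Gt30 (show g.1.right ∈ Gt30 from g.2) with ⟨s, α, h⟩ | ⟨s, α, h⟩
  · refine ⟨s, α, Or.inl fun t θ => mk_eq_coset (g * boostRotG t θ) _ _ 1 (one_mem _) ?_⟩
    show g.1.right * boostRot t θ = _
    rw [h, boostRot_mul, mul_one]
  · refine ⟨s, α, Or.inr fun t θ => mk_eq_coset (g * boostRotG t θ) _ _ r1Pi
      (Subgroup.mem_zpowers _) ?_⟩
    show g.1.right * boostRot t θ = _
    rw [h, mul_assoc, r1Pi_mul_boostRot, ← mul_assoc, boostRot_mul]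

/-- Invariance of `dt dθ` under translations and reflections, for cosets that are `2π`-periodic
in `θ`. -/
lemma map_strip_eq {Y : Type*} [MeasurableSpace Y] (c : ℝ → ℝ → Y)
    (hc : Measurable fun p : ℝ × ℝ => c p.1 p.2)
    (hper : ∀ t, Function.Periodic (c t) (2 * Real.pi)) (F : Y → Y) (hF : Measurable F)
    (hFc : ∃ s α : ℝ, (∀ t θ, F (c t θ) = c (t + s) (θ + α)) ∨
      ∀ t θ, F (c t θ) = c (-t + s) (-θ + α)) :
    let ν := Measure.map (fun p : ℝ × ℝ => c p.1 p.2)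
      ((volume : Measure ℝ).prod (volume.restrict (Set.Ioc 0 (2 * Real.pi))))
    Measure.map F ν = ν := by
  intro ν
  have : Fact (0 < 2 * Real.pi) := ⟨by positivity⟩
  let q : ℝ × AddCircle (2 * Real.pi) → Y := fun p =>
    c p.1 (AddCircle.measurableEquivIoc (2 * Real.pi) 0 p.2)
  have hq : Measurable q := hc.comp
    (measurable_fst.prodMk (measurable_subtype_coe.comp
      ((AddCircle.measurableEquivIoc (2 * Real.pi) 0).measurable.comp measurable_snd)))
  have hqc : ∀ t θ : ℝ, q (t, (θ : AddCircle (2 * Real.pi))) = c t θ := by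
    intro t θ
    have h2 := AddCircle.coe_equivIoc (p := 2 * Real.pi) (a := 0) (y := (θ : AddCircle (2 * Real.pi)))
    have h3 := congrArg (hper t).lift h2
    rw [Function.Periodic.lift_coe, Function.Periodic.lift_coe] at h3
    exact h3
  have hmk := (MeasurePreserving.id (volume : Measure ℝ)).prod
    (AddCircle.measurePreserving_mk (2 * Real.pi) 0)
  rw [zero_add] at hmk
  have hν : ν = ((volume : Measure ℝ).prod (volume : Measure (AddCircle (2 * Real.pi)))).map q := by
    rw [← hmk.map_eq, Measure.map_map hq hmk.measurable]
    have e : (fun p : ℝ × ℝ => c p.1 p.2)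
        = q ∘ Prod.map id ((↑) : ℝ → AddCircle (2 * Real.pi)) :=
      funext fun p => (hqc p.1 p.2).symm
    rw [← e]
  obtain ⟨s, α, h | h⟩ := hFc
  · have hT := (measurePreserving_add_right (volume : Measure ℝ) s).prod
      (measurePreserving_add_right (volume : Measure (AddCircle (2 * Real.pi)))
        (α : AddCircle (2 * Real.pi)))
    have e : F ∘ q = q ∘ Prod.map (fun t => t + s) (fun x => x + (α : AddCircle (2 * Real.pi))) := by
      funext ⟨t, x⟩
      obtain ⟨θ, rfl⟩ := QuotientAddGroup.mk_surjective x
      exact (congrArg F (hqc t θ)).trans ((h t θ).trans (hqc (t + s) (θ + α)).symm)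
    rw [hν, Measure.map_map hF hq, e, ← Measure.map_map hq hT.measurable, hT.map_eq]
  · have hT := ((measurePreserving_add_right (volume : Measure ℝ) s).comp
        (Measure.measurePreserving_neg volume)).prod
      ((measurePreserving_add_right (volume : Measure (AddCircle (2 * Real.pi)))
        (α : AddCircle (2 * Real.pi))).comp (Measure.measurePreserving_neg volume))
    have e : F ∘ q = q ∘ Prod.map ((fun t => t + s) ∘ Neg.neg)
        ((fun x => x + (α : AddCircle (2 * Real.pi))) ∘ Neg.neg) := by
      funext ⟨t, x⟩
      obtain ⟨θ, rfl⟩ := QuotientAddGroup.mk_surjective x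
      exact (congrArg F (hqc t θ)).trans ((h t θ).trans (hqc (-t + s) (-θ + α)).symm)
    rw [hν, Measure.map_map hF hq, e, ← Measure.map_map hq hT.measurable, hT.map_eq]

lemma measurePreserving_orbitMeasure (g : Gt3) :
    MeasurePreserving (fun x : Gt3 ⧸ stab => g • x) orbitMeasure orbitMeasure :=
  ⟨measurable_smul_coset g, map_strip_eq coset measurable_coset coset_periodic _
    (measurable_smul_coset g) (smul_coset g)⟩

/-- The massless representation `W_{r,n} = Ind_{ℝ^{1+3} ⋊ ⟨r₁(π)⟩}^{G̃₃} (χ_{q_r} · V_n)`. -/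
def masslessRep (r : ℝ) (n : Fin 4) :
    UnitaryRep Gt3 (InducedSpace (stabChar r n) orbitMeasure) :=
  inducedRep (stabChar r n) orbitMeasure measurePreserving_orbitMeasure

/-- The massless representation `W_{r,n}` of `G̃_W = g G̃₃ g⁻¹`, for the wedge `W = g W₃`. -/
def masslessRepW (g : Poincare) (r : ℝ) (n : Fin 4) :
    UnitaryRep (GtW g) (InducedSpace (stabChar r n) orbitMeasure) :=
  (masslessRep r n).comp ((MulAut.conj g).subgroupMap Gt3).symm.toMonoidHom

/-! ### Every wedge is mapped to its spacelike complement by an element of `G̃_W` -/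

lemma act_mul (g h : Poincare) (x : Minkowski) : act (g * h) x = act g (act h x) := by
  show (g.left.toAdd + lorentz g.right h.left.toAdd) + lorentz (g.right * h.right) x
    = g.left.toAdd + lorentz g.right (h.left.toAdd + lorentz h.right x)
  rw [lorentz_add, lorentz_mul, add_assoc]

lemma act_one (x : Minkowski) : act 1 x = x := by
  show (0 : Minkowski) + lorentz 1 x = x
  rw [lorentz_one, zero_add]

lemma minkowskiProd_self_lorentz (A : SL2C) (x : Minkowski) :
    minkowskiProd (lorentz A x) (lorentz A x) = minkowskiProd x x := by
  have h : ∀ y : Minkowski, ((minkowskiProd y y : ℝ) : ℂ) = (toHerm y).det := by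
    intro y
    rw [toHerm, Matrix.det_fin_two_of, minkowskiProd]
    push_cast
    linear_combination (-(y 2 : ℂ) ^ 2) * Complex.I_sq
  have h2 : (toHerm (lorentz A x)).det = (toHerm x).det := by
    rw [toHerm_lorentz, Matrix.det_mul, Matrix.det_mul, Matrix.det_conjTranspose, A.2]
    simp
  exact_mod_cast (h _).trans (h2.trans (h x).symm)

/-- The action of a Poincaré transformation as a homeomorphism. -/
def actHomeo (g : Poincare) : Minkowski ≃ₜ Minkowski where
  toFun := act g
  invFun := act g⁻¹
  left_inv x := by rw [← act_mul, inv_mul_cancel, act_one]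
  right_inv x := by rw [← act_mul, mul_inv_cancel, act_one]
  continuous_toFun := continuous_const.add (continuous_lorentz g.right)
  continuous_invFun := continuous_const.add (continuous_lorentz g⁻¹.right)

lemma spacelikeComplement_act (g : Poincare) (S : Set Minkowski) :
    spacelikeComplement (act g '' S) = act g '' spacelikeComplement S := by
  have h := (actHomeo g).image_interior {x | ∀ y ∈ S, minkowskiProd (x - y) (x - y) < 0}
  show _ = actHomeo g '' interior _
  rw [h]
  unfold spacelikeComplement
  congr 1
  have hinv : ∀ x y, minkowskiProd (act g x - act g y) (act g x - act g y)
      = minkowskiProd (x - y) (x - y) := by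
    intro x y
    have e : act g x - act g y = lorentz g.right (x - y) := by
      have := lorentz_add g.right (x - y) y
      rw [sub_add_cancel] at this
      rw [act, act, this]
      abel
    rw [e, minkowskiProd_self_lorentz]
  ext z
  constructor
  · intro hz
    refine ⟨(actHomeo g).symm z, fun y hy => ?_, (actHomeo g).apply_symm_apply z⟩
    have h1 := hz (act g y) (Set.mem_image_of_mem _ hy)
    rw [← hinv]
    have h2 : act g ((actHomeo g).symm z) = z := (actHomeo g).apply_symm_apply z
    rwa [h2]
  · rintro ⟨x, hx, rfl⟩ _ ⟨y, hy, rfl⟩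
    have := hx y hy
    rw [← hinv] at this
    exact this

lemma spacelikeComplement_wedge3 : spacelikeComplement wedge3 = {x | |x 0| < -x 3} := by
  have hcl : {x : Minkowski | ∀ y ∈ wedge3, minkowskiProd (x - y) (x - y) < 0}
      = {x | |x 0| ≤ -x 3} := by
    ext x
    simp only [Set.mem_ofPred_eq]
    constructor
    · intro h
      -- otherwise some point of the wedge is not spacelike to `x`
      have key : ∀ u v : ℝ, 0 < u → v < 0 → ¬ 0 ≤ (x 0 + x 3 - u) * (x 0 - x 3 - v) := by
        intro u v hu hv hle
        have h1 := h ![(u + v) / 2, x 1, x 2, (u - v) / 2] (by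
          simp only [wedge3, Set.mem_ofPred_eq, abs_lt]
          simp
          constructor <;> linarith)
        simp [minkowskiProd] at h1
        nlinarith
      rw [abs_le]
      constructor
      · by_contra hx
        exact key (x 3 - x 0 + |x 0 + x 3| + |x 0 - x 3| + 1) ((x 0 - x 3) / 2)
          (by linarith [abs_nonneg (x 0 + x 3), neg_abs_le (x 0 - x 3), le_abs_self (x 0 - x 3)])
          (by linarith) (mul_nonneg_of_nonpos_of_nonpos
            (by linarith [le_abs_self (x 0 + x 3), abs_nonneg (x 0 - x 3)]) (by linarith))
      · by_contra hx
        exact key ((x 0 + x 3) / 2) (-(|x 0 - x 3| + 1)) (by linarith)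
          (by linarith [abs_nonneg (x 0 - x 3)])
          (mul_nonneg (by linarith) (by linarith [neg_abs_le (x 0 - x 3)]))
    · intro h y hy
      have hy' := abs_lt.1 (show |y 0| < y 3 from hy)
      have hx' := abs_le.1 h
      simp only [minkowskiProd, Pi.sub_apply]
      nlinarith [mul_pos (show 0 < -(x 3 - y 3) + (x 0 - y 0) by linarith)
        (show 0 < -(x 3 - y 3) - (x 0 - y 0) by linarith), mul_self_nonneg (x 1 - y 1),
        mul_self_nonneg (x 2 - y 2)]
  rw [spacelikeComplement, hcl]
  refine Set.Subset.antisymm (fun x hx => ?_) ?_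
  · have hcont : Tendsto (fun ε : ℝ => x + ε • (Pi.single 3 1 : Minkowski)) (𝓝[>] 0) (𝓝 x) := by
      refine tendsto_nhdsWithin_of_tendsto_nhds ?_
      have : Continuous fun ε : ℝ => x + ε • (Pi.single 3 1 : Minkowski) := by fun_prop
      simpa using this.tendsto 0
    have hev := hcont.eventually (mem_interior_iff_mem_nhds.1 hx)
    obtain ⟨ε, h1, h2⟩ := (hev.and self_mem_nhdsWithin).exists
    have h1' : |(x + ε • (Pi.single 3 1 : Minkowski)) 0|
      ≤ -(x + ε • (Pi.single 3 1 : Minkowski)) 3 := h1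
    simp at h1'
    have h2' : 0 < ε := h2
    show |x 0| < -x 3
    linarith
  · refine interior_maximal (fun x (hx : |x 0| < -x 3) => show |x 0| ≤ -x 3 from hx.le) ?_
    exact isOpen_lt (by fun_prop) (by fun_prop)

lemma act_r1Pi_wedge3 : act (SemidirectProduct.inr r1Pi) '' wedge3 = spacelikeComplement wedge3 := by
  have h : ∀ x, act (SemidirectProduct.inr r1Pi) x = ![x 0, x 1, -x 2, -x 3] := by
    intro x
    show (0 : Minkowski) + lorentz r1Pi x = _
    rw [zero_add]
    ext i
    fin_cases i <;> simp [lorentz, ofHerm, toHerm, r1Pi_val, Matrix.mul_apply, Fin.sum_univ_two]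
    ring
  rw [spacelikeComplement_wedge3]
  ext z
  constructor
  · rintro ⟨x, hx, rfl⟩
    rw [h]
    simpa [wedge3] using hx
  · intro hz
    refine ⟨![z 0, z 1, -z 2, -z 3], by simpa [wedge3] using hz, ?_⟩
    rw [h]
    ext i
    fin_cases i <;> simp

/-- There are elements `r_W ∈ G̃_W` with `r_W W = W'`. -/
lemma exists_flip (g : Poincare) :
    ∃ w : GtW g, act w '' wedge g = spacelikeComplement (wedge g) := by
  refine ⟨⟨g * SemidirectProduct.inr r1Pi * g⁻¹, SemidirectProduct.inr r1Pi, ?_, rfl⟩, ?_⟩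
  · exact Subgroup.mem_sup_right (Subgroup.mem_zpowers r1Pi)
  · rw [wedge, spacelikeComplement_act, ← act_r1Pi_wedge3, ← Set.image_comp, ← Set.image_comp]
    refine Set.image_congr fun x _ => ?_
    show act (g * SemidirectProduct.inr r1Pi * g⁻¹) (act g x) = _
    rw [← act_mul, inv_mul_cancel_right, act_mul]
    rfl

/-! ### The modularity condition -/

/-- The modularity condition, for the wedge `W = g W₃`, of a representation `U` of `G̃_W`:
`U(r_W) ∈ U(G_W)''` for the elements `r_W` with `r_W W = W'`. -/
def ModularityCondition (g : Poincare) {H : Type*} [NormedAddCommGroup H] [InnerProductSpace ℂ H]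
    (U : UnitaryRep (GtW g) H) : Prop :=
  ∀ w : GtW g, act w '' wedge g = spacelikeComplement (wedge g) →
    U.op w ∈ doubleCommutant {T | ∃ h : GtW g, (h : Poincare) ∈ GW g ∧ U.op h = T}

end MasslessMC

end

noncomputable section

namespace MasslessMC

/-! ### Uniqueness of Fourier transforms of integrable densities -/

section Fourier

variable {X : Type*} [MeasurableSpace X] {ν : Measure X}
  {V : Type*} [NormedAddCommGroup V] [InnerProductSpace ℝ V] [SecondCountableTopology V]
  [MeasurableSpace V] [BorelSpace V]

/-! An operator `T` commuting with `U(G_W)` has to be shown to commute with `U(w)`; this holds for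
every `w` in `G̃_W`. Two facts carry the proof.

Inside one fibre: the boosts and rotations in `G₃` are already transitive on the orbit of `q_r`. The
coordinates `(t, θ)` turn vectors of `W_{r,n}` into square-integrable functions on the strip `ℝ ×
(0, 2π]`; translations multiply them by the characters `z ↦ exp(i p(z)·a)`, while boosts and
rotations shift `z`. An operator commuting with both kinds is a scalar
(`exists_eq_smul_of_commute`), so it commutes with `W_{r,n}(w)` too. The implication "commutes with
the subgroup, hence with `w`" survives passage to multiples (`CommutantFixes.of_isMultipleOf`).

Across the fibres: `r` can be read off from translations alone, since `p₁² + p₂² = r²` on the orbit,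
whatever `n` is. The average of the translations by `±ε e₁` and `±ε e₂` (conjugated by `g` for a
general wedge) is multiplication by `(cos(εr cos θ) + cos(εr sin θ))/2`, which is close to
`exp(-(εr)²/4)`. As in the central limit theorem, with `ε = N^(-1/2)` its powers of order `N m`
converge strongly to `exp(-r²/4)^m` (`tendsto_walk_pow_of_isMultipleOf`). `T` commutes with these
powers, and moments against the injective function `exp(-r²/4)` determine an integrable function of
`r`. Hence `⟪(T*s)(r), t(r)⟫ = ⟪s(r), (Tt)(r)⟫` for almost every `r` (`ae_inner_eval_eq`). This is
decomposability of `T` in weak form; no field of operators `T_r` is ever constructed, and the choice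
of `n(r)` needs no measurability.

The two facts are joined through matrix coefficients: the weak identity, applied to `U(h)t` for `h`
in a countable subgroup of `G_W`, holds for all these `h` at once for almost every `r`;
`CommutantFixes.inner_eq_inner` carries it over to `w` in each fibre, and integration over `r`
finishes the proof. -/

lemma charFun_map_withDensity {p : X → V} (hp : Measurable p) {f : X → ℝ}
    (hf : AEMeasurable f ν) (hf0 : ∀ x, 0 ≤ f x) (a : V) :
    charFun ((ν.withDensity fun x => ENNReal.ofReal (f x)).map p) a
      = ∫ x, Complex.exp (⟪p x, a⟫_ℝ * Complex.I) * f x ∂ν := by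
  rw [charFun_apply, integral_map hp.aemeasurable (by fun_prop),
    integral_withDensity_eq_integral_toReal_smul₀ hf.ennreal_ofReal (by simp)]
  refine integral_congr_ae (Eventually.of_forall fun x => ?_)
  simp [ENNReal.toReal_ofReal (hf0 x), mul_comm]

variable [StandardBorelSpace X] [CompleteSpace V]

/-- An integrable real function on a standard Borel space whose Fourier transform, read through an
almost everywhere injective map to a Hilbert space, vanishes is zero almost everywhere. -/
lemma ae_eq_zero_of_integral_exp_inner_real {p : X → V} (hp : Measurable p) {A : Set X}
    (hA : MeasurableSet A) (hνA : ∀ᵐ x ∂ν, x ∈ A) (hinj : Set.InjOn p A) {f : X → ℝ}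
    (hf : Integrable f ν)
    (h : ∀ a : V, ∫ x, Complex.exp (⟪p x, a⟫_ℝ * Complex.I) * f x ∂ν = 0) : f =ᵐ[ν] 0 := by
  have hpos : Integrable (fun x => max (f x) 0) ν := hf.pos_part
  have hneg : Integrable (fun x => max (-f x) 0) ν := hf.neg_part
  have hexp : ∀ (a : V) (k : X → ℝ), Integrable k ν →
      Integrable (fun x => Complex.exp (⟪p x, a⟫_ℝ * Complex.I) * k x) ν := by
    intro a k hk
    refine hk.ofReal.bdd_mul (c := 1) ?_ (Eventually.of_forall fun x => ?_)
    · exact Measurable.aestronglyMeasurable (by fun_prop)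
    · rw [Complex.norm_exp_ofReal_mul_I]
  have hfin : ∀ k : X → ℝ, Integrable k ν →
      IsFiniteMeasure (ν.withDensity fun x => ENNReal.ofReal (k x)) := fun k hk =>
    isFiniteMeasure_withDensity_ofReal hk.2
  have := hfin _ hpos
  have := hfin _ hneg
  -- The positive and negative parts of `f` are densities of two finite measures; the hypothesis
  -- says that their images under `p` have the same characteristic function.
  have hmap : (ν.withDensity fun x => ENNReal.ofReal (max (f x) 0)).map p
      = (ν.withDensity fun x => ENNReal.ofReal (max (-f x) 0)).map p := by
    refine Measure.ext_of_charFun (funext fun a => ?_)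
    rw [charFun_map_withDensity hp hpos.aemeasurable (fun x => le_max_right _ _),
      charFun_map_withDensity hp hneg.aemeasurable (fun x => le_max_right _ _), ← sub_eq_zero,
      ← integral_sub (hexp a _ hpos) (hexp a _ hneg), ← h a]
    refine integral_congr_ae (Eventually.of_forall fun x => ?_)
    have e : f x = max (f x) 0 - max (-f x) 0 := by
      rcases le_total (f x) 0 with hx | hx <;> simp [hx]
    simp only
    rw [← mul_sub, ← Complex.ofReal_sub, ← e]
  refine hf.ae_eq_zero_of_forall_setIntegral_eq_zero fun B hB _ => ?_
  -- Lusin–Souslin: on a standard Borel space an injective measurable map has measurable images. So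
  -- every measurable `B` is, up to a null set, a preimage under `p`, and nothing is lost in passing
  -- to the image measures.
  have hD : MeasurableSet (p '' (B ∩ A)) :=
    (hB.inter hA).image_of_measurable_injOn hp (hinj.mono Set.inter_subset_right)
  have hae : (p ⁻¹' (p '' (B ∩ A)) : Set X) =ᵐ[ν] B := by
    filter_upwards [hνA] with x hx
    refine propext ⟨?_, fun hxB => ⟨x, ⟨hxB, hx⟩, rfl⟩⟩
    rintro ⟨y, ⟨hy, hyA⟩, hxy⟩
    rwa [← hinj hyA hx hxy]
  have hBeq := congrArg (fun m => m (p '' (B ∩ A))) hmap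
  simp only [Measure.map_apply hp hD] at hBeq
  rw [withDensity_apply _ (hp hD), withDensity_apply _ (hp hD), Measure.restrict_congr_set hae]
    at hBeq
  rw [integral_eq_lintegral_pos_part_sub_lintegral_neg_part hf.integrableOn]
  have e : ∀ y : ℝ, ENNReal.ofReal (max y 0) = ENNReal.ofReal y := fun y => by
    rcases le_total y 0 with hy | hy <;> simp [hy, ENNReal.ofReal_of_nonpos]
  simp only [e] at hBeq
  rw [hBeq, sub_self]

/-- The complex version of `ae_eq_zero_of_integral_exp_inner_real`. -/
lemma ae_eq_zero_of_integral_exp_inner {p : X → V} (hp : Measurable p) {A : Set X}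
    (hA : MeasurableSet A) (hνA : ∀ᵐ x ∂ν, x ∈ A) (hinj : Set.InjOn p A) {F : X → ℂ}
    (hF : Integrable F ν)
    (h : ∀ a : V, ∫ x, Complex.exp (⟪p x, a⟫_ℝ * Complex.I) * F x ∂ν = 0) : F =ᵐ[ν] 0 := by
  -- Conjugation replaces `a` by `-a`, so the transform of the conjugate of `F` vanishes as well;
  -- real and imaginary parts are combinations of the two.
  have hconj : ∀ a : V, ∫ x, Complex.exp (⟪p x, a⟫_ℝ * Complex.I) * (starRingEnd ℂ) (F x) ∂ν
      = 0 := by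
    intro a
    have h1 := congrArg (starRingEnd ℂ) (h (-a))
    rw [← integral_conj, map_zero] at h1
    rw [← h1]
    refine integral_congr_ae (Eventually.of_forall fun x => ?_)
    simp [← Complex.exp_conj]
  have hexp : ∀ (a : V) (k : X → ℂ), Integrable k ν →
      Integrable (fun x => Complex.exp (⟪p x, a⟫_ℝ * Complex.I) * k x) ν := by
    intro a k hk
    refine hk.bdd_mul (c := 1) ?_ (Eventually.of_forall fun x => ?_)
    · exact Measurable.aestronglyMeasurable (by fun_prop)
    · rw [Complex.norm_exp_ofReal_mul_I]
  have hFc : Integrable (fun x => (starRingEnd ℂ) (F x)) ν := by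
    refine hF.mono (Complex.continuous_conj.comp_aestronglyMeasurable hF.1) ?_
    exact Eventually.of_forall fun x => by simp
  have hre := ae_eq_zero_of_integral_exp_inner_real hp hA hνA hinj hF.re fun a => by
    have h1 : ∫ x, (Complex.exp (⟪p x, a⟫_ℝ * Complex.I) * F x
        + Complex.exp (⟪p x, a⟫_ℝ * Complex.I) * (starRingEnd ℂ) (F x)) / 2 ∂ν = 0 := by
      rw [integral_div, integral_add (hexp a _ hF) (hexp a _ hFc), h, hconj]
      simp
    rw [← h1]
    refine integral_congr_ae (Eventually.of_forall fun x => ?_)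
    simp only [RCLike.re_eq_complex_re]
    rw [Complex.re_eq_add_conj]
    ring
  have him := ae_eq_zero_of_integral_exp_inner_real hp hA hνA hinj hF.im fun a => by
    have h1 : ∫ x, (Complex.exp (⟪p x, a⟫_ℝ * Complex.I) * F x
        - Complex.exp (⟪p x, a⟫_ℝ * Complex.I) * (starRingEnd ℂ) (F x)) / (2 * Complex.I) ∂ν = 0 := by
      rw [integral_div, integral_sub (hexp a _ hF) (hexp a _ hFc), h, hconj]
      simp
    rw [← h1]
    refine integral_congr_ae (Eventually.of_forall fun x => ?_)
    simp only [RCLike.im_eq_complex_im]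
    rw [Complex.im_eq_sub_conj]
    ring
  filter_upwards [hre, him] with x h1 h2
  exact Complex.ext h1 h2

/-- It is enough that the Fourier transform vanishes on a dense set. -/
lemma ae_eq_zero_of_integral_exp_inner_dense {p : X → V} (hp : Measurable p) {A : Set X}
    (hA : MeasurableSet A) (hνA : ∀ᵐ x ∂ν, x ∈ A) (hinj : Set.InjOn p A) {F : X → ℂ}
    (hF : Integrable F ν) {D : Set V} (hD : Dense D)
    (h : ∀ a ∈ D, ∫ x, Complex.exp (⟪p x, a⟫_ℝ * Complex.I) * F x ∂ν = 0) : F =ᵐ[ν] 0 := by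
  have hcont : Continuous fun a : V => ∫ x, Complex.exp (⟪p x, a⟫_ℝ * Complex.I) * F x ∂ν := by
    refine continuous_of_dominated (bound := fun x => ‖F x‖) (fun a => ?_) (fun a => ?_) hF.norm ?_
    · exact (Measurable.aestronglyMeasurable (by fun_prop)).mul hF.1
    · exact Eventually.of_forall fun x => by simp [Complex.norm_exp_ofReal_mul_I]
    · exact Eventually.of_forall fun x => by fun_prop
  refine ae_eq_zero_of_integral_exp_inner hp hA hνA hinj hF fun a => ?_
  exact congrFun (Continuous.ext_on hD hcont continuous_const h) a

/-- An integrable function is determined by its moments against an injective function with values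
in `[-1, 1]`. -/
lemma ae_eq_zero_of_integral_pow {u : X → ℝ} (hu : Measurable u) (hinj : Function.Injective u)
    (hu1 : ∀ x, |u x| ≤ 1) {F : X → ℂ} (hF : Integrable F ν)
    (h : ∀ m : ℕ, ∫ x, (u x : ℂ) ^ m * F x ∂ν = 0) : F =ᵐ[ν] 0 := by
  refine ae_eq_zero_of_integral_exp_inner hu MeasurableSet.univ (by simp) hinj.injOn hF fun a => ?_
  have hs : HasSum (fun m : ℕ => ∫ x, ((a * Complex.I) ^ m / m.factorial) * ((u x : ℂ) ^ m * F x) ∂ν)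
      -- The exponential series is integrated term by term; `|u| ≤ 1` gives the dominating terms
      -- `|a|^m / m! * ‖F‖`. Each integral on the left is a multiple of a moment.
      (∫ x, Complex.exp (⟪u x, a⟫_ℝ * Complex.I) * F x ∂ν) := by
    refine hasSum_integral_of_dominated_convergence
      (fun m x => (|a| ^ m / m.factorial) * ‖F x‖) (fun m => ?_) (fun m => ?_) ?_ ?_ ?_
    · exact ((Measurable.aestronglyMeasurable (by fun_prop)).mul hF.1).const_mul _
    · refine Eventually.of_forall fun x => ?_
      simp only [norm_mul, norm_div, norm_pow, Complex.norm_I, Complex.norm_real, mul_one,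
        Complex.norm_natCast, Real.norm_eq_abs]
      refine mul_le_mul_of_nonneg_left ?_ (by positivity)
      exact mul_le_of_le_one_left (norm_nonneg _) (pow_le_one₀ (abs_nonneg _) (hu1 x))
    · exact Eventually.of_forall fun x => (Real.summable_pow_div_factorial _).mul_right _
    · simp_rw [tsum_mul_right]
      exact hF.norm.const_mul _
    · refine Eventually.of_forall fun x => ?_
      have h1 := (NormedSpace.expSeries_div_hasSum_exp (((u x : ℂ) * a) * Complex.I)).mul_right (F x)
      rw [← Complex.exp_eq_exp_ℂ] at h1
      have e : ((⟪u x, a⟫_ℝ : ℝ) : ℂ) = (u x : ℂ) * a := by simp [mul_comm]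
      rw [e]
      have e2 : (fun m : ℕ => ((a : ℂ) * Complex.I) ^ m / m.factorial * ((u x : ℂ) ^ m * F x))
          = fun m : ℕ => ((u x : ℂ) * a * Complex.I) ^ m / m.factorial * F x := by
        funext m
        rw [mul_pow, mul_pow, mul_pow]
        ring
      rw [e2]
      exact h1
  rw [← hs.tsum_eq]
  simp_rw [integral_const_mul, h]
  simp

end Fourier

/-! ### Continuity of translations in `L²` of a strip -/

/-- The measure `dt dθ` on the strip `θ ∈ (0, 2π]`. -/
def stripMeasure : Measure (ℝ × ℝ) :=
  (volume : Measure ℝ).prod (volume.restrict (Set.Ioc 0 (2 * Real.pi)))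

lemma stripMeasure_eq :
    stripMeasure = volume.restrict (Set.univ ×ˢ Set.Ioc (0 : ℝ) (2 * Real.pi)) := by
  rw [stripMeasure, Measure.volume_eq_prod, ← Measure.prod_restrict, Measure.restrict_univ]

instance : SFinite stripMeasure := by
  unfold stripMeasure
  infer_instance

/-- Composition with measure preserving maps is continuous on `L²` with respect to the compact-open
topology on the maps. Translations depend continuously on `s` in that topology; the rest rewrites
the `L²` norm as an integral. -/
lemma tendsto_lintegral_translate {G : ℝ × ℝ → ℂ} (hG : MemLp G 2 volume) :
    Tendsto (fun s : ℝ × ℝ => ∫⁻ z, ENNReal.ofReal (‖G (z - s) - G z‖ ^ 2)) (𝓝 0) (𝓝 0) := by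
  let τ : ℝ × ℝ → C(ℝ × ℝ, ℝ × ℝ) := fun s => ⟨fun z => z - s, by fun_prop⟩
  have hτ : Continuous τ := by
    refine ContinuousMap.continuous_of_continuous_uncurry _ ?_
    show Continuous fun q : (ℝ × ℝ) × (ℝ × ℝ) => q.2 - q.1
    fun_prop
  have hmp : ∀ s, MeasurePreserving (τ s) (volume : Measure (ℝ × ℝ)) volume := fun s =>
    measurePreserving_sub_right volume s
  have hc := (continuous_const (y := hG.toLp G)).compMeasurePreservingLp hτ hmp (by simp)
  have h0 : Lp.compMeasurePreserving (τ 0) (hmp 0) (hG.toLp G) = hG.toLp G := by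
    refine Lp.ext ((Lp.coeFn_compMeasurePreserving _ _).trans ?_)
    refine Eventually.of_forall fun z => ?_
    simp [τ]
  have ht := ((hc.tendsto 0).sub_const (hG.toLp G)).enorm
  rw [h0, sub_self, enorm_zero] at ht
  have ht2 := ENNReal.Tendsto.pow (n := 2) ht
  simp only [ne_eq, OfNat.ofNat_ne_zero, not_false_eq_true, zero_pow] at ht2
  refine ht2.congr fun s => ?_
  rw [Lp.enorm_def]
  have e := eLpNorm_nnreal_pow_eq_lintegral (μ := (volume : Measure (ℝ × ℝ))) (p := 2)
    (f := (Lp.compMeasurePreserving (τ s) (hmp s) (hG.toLp G) - hG.toLp G : Lp ℂ 2 _)) (by simp)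
  have e2 : ((2 : NNReal) : ℝ) = ((2 : ℕ) : ℝ) := by norm_num
  rw [e2, ENNReal.rpow_natCast] at e
  refine Eq.trans e (lintegral_congr_ae ?_)
  filter_upwards [Lp.coeFn_sub (Lp.compMeasurePreserving (τ s) (hmp s) (hG.toLp G)) (hG.toLp G),
    Lp.coeFn_compMeasurePreserving (hG.toLp G) (hmp s), hG.coeFn_toLp,
    (hmp s).quasiMeasurePreserving.ae hG.coeFn_toLp] with z h1 h2 h3 h4
  rw [h1, Pi.sub_apply, h2, h3, Function.comp_apply, h4, ENNReal.ofReal_pow (norm_nonneg _),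
    ofReal_norm, ENNReal.rpow_natCast]
  rfl

/-- Functions coming from `W_{r,n}` have periodic modulus in `θ`, so apart from null functions they
are not square-integrable on the whole plane. For small `s` only their values on three periods
matter, and cutting off there reduces the claim to `tendsto_lintegral_translate`. -/
lemma tendsto_strip_translate {F : ℝ × ℝ → ℂ} (hF : Measurable F)
    (hfin : ∫⁻ z in Set.univ ×ˢ Set.Ioc (-(2 * Real.pi)) (4 * Real.pi),
      ENNReal.ofReal (‖F z‖ ^ 2) < ∞) :
    Tendsto (fun s : ℝ × ℝ => ∫⁻ z, ENNReal.ofReal (‖F (z - s) - F z‖ ^ 2) ∂stripMeasure)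
      (𝓝 0) (𝓝 0) := by
  have hpi := Real.pi_pos
  set S : Set (ℝ × ℝ) := Set.univ ×ˢ Set.Ioc (-(2 * Real.pi)) (4 * Real.pi) with hS
  have hSm : MeasurableSet S := MeasurableSet.univ.prod measurableSet_Ioc
  have hG : MemLp (S.indicator F) 2 volume := by
    rw [memLp_indicator_iff_restrict hSm]
    rw [memLp_two_iff_integrable_sq_norm hF.aestronglyMeasurable]
    refine ⟨(hF.norm.pow_const 2).aestronglyMeasurable, ?_⟩
    rw [hasFiniteIntegral_iff_ofReal (Eventually.of_forall fun x => by positivity)]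
    exact hfin
  refine tendsto_of_tendsto_of_tendsto_of_le_of_le' tendsto_const_nhds
    (tendsto_lintegral_translate hG) (Eventually.of_forall fun _ => zero_le) ?_
  -- For a shift shorter than one period, `z` in the strip keeps both `z` and `z - s` inside the
  -- wide strip, where the cut-off function agrees with `F`.
  filter_upwards [Metric.ball_mem_nhds (0 : ℝ × ℝ) (show 0 < 2 * Real.pi by positivity)] with s hs
  rw [stripMeasure_eq, ← lintegral_indicator (MeasurableSet.univ.prod measurableSet_Ioc)]
  refine lintegral_mono fun z => ?_
  by_cases hz : z ∈ (Set.univ ×ˢ Set.Ioc (0 : ℝ) (2 * Real.pi) : Set (ℝ × ℝ))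
  · rw [Set.indicator_of_mem hz]
    have hz2 := hz.2
    have hs2 : |s.2| < 2 * Real.pi := by
      have h1 : ‖s‖ < 2 * Real.pi := by simpa using hs
      exact (norm_snd_le s).trans_lt h1
    rw [abs_lt] at hs2
    have m1 : z ∈ S := ⟨trivial, by constructor <;> linarith [hz2.1, hz2.2]⟩
    have m2 : z - s ∈ S := ⟨trivial, by
      constructor <;> simp only [Prod.snd_sub] <;> linarith [hz2.1, hz2.2]⟩
    rw [Set.indicator_of_mem m1, Set.indicator_of_mem m2]
  · rw [Set.indicator_of_notMem hz]
    exact zero_le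

/-! ### The massless representations in the coordinates `(t, θ)` -/

/-- The translation by `a` as an element of `G̃₃`. -/
def transG (a : Minkowski) : Gt3 :=
  ⟨SemidirectProduct.inl (Multiplicative.ofAdd a), one_mem Gt30⟩

lemma boostRotG_inv_mul (t θ s α : ℝ) :
    (boostRotG s α)⁻¹ * boostRotG t θ = boostRotG (t - s) (θ - α) := by
  rw [inv_mul_eq_iff_eq_mul]
  apply Subtype.ext
  show SemidirectProduct.inr (boostRot t θ)
    = SemidirectProduct.inr (boostRot s α) * SemidirectProduct.inr (boostRot (t - s) (θ - α))
  rw [← map_mul, boostRot_mul, sub_add_cancel, sub_add_cancel]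

lemma boostRot_inv (t θ : ℝ) : (boostRot t θ)⁻¹ = boostRot (-t) (-θ) := by
  rw [inv_eq_iff_mul_eq_one, boostRot_mul]
  apply Subtype.ext
  ext i j
  fin_cases i <;> fin_cases j <;> simp [boostRot]

/-- The point `Λ(λ₃(t) r₃(θ)) q_r` of the orbit of `q_r`, as a linear form on `ℝ⁴`. -/
def momentum (r : ℝ) (z : ℝ × ℝ) : EuclideanSpace ℝ (Fin 4) :=
  !₂[r * Real.cosh z.1, -(r * Real.cos z.2), r * Real.sin z.2, -(r * Real.sinh z.1)]

lemma inner_momentum (r : ℝ) (z : ℝ × ℝ) (a : Minkowski) :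
    ⟪momentum r z, WithLp.toLp 2 a⟫_ℝ = r * (Real.cosh z.1 * a 0 - Real.cos z.2 * a 1
      + Real.sin z.2 * a 2 - Real.sinh z.1 * a 3) := by
  simp [momentum, PiLp.inner_apply, Fin.sum_univ_four]
  ring

lemma measurable_momentum (r : ℝ) : Measurable (momentum r) := by
  refine Continuous.measurable ?_
  refine (PiLp.continuous_toLp 2 _).comp (continuous_pi fun i => ?_)
  fin_cases i <;> simp <;> fun_prop

lemma injOn_momentum {r : ℝ} (hr : 0 < r) :
    Set.InjOn (momentum r) (Set.univ ×ˢ Set.Ioc (0 : ℝ) (2 * Real.pi)) := by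
  rintro ⟨t, θ⟩ ⟨-, hθ⟩ ⟨t', θ'⟩ ⟨-, hθ'⟩ h
  have h' : ∀ i, momentum r (t, θ) i = momentum r (t', θ') i := fun i => by rw [h]
  have h1 := h' 1
  have h2 := h' 2
  have h3 := h' 3
  simp [momentum, hr.ne'] at h1 h2 h3
  have hθθ : (θ : Real.Angle) = θ' := Real.Angle.cos_sin_inj h1 h2
  obtain ⟨k, hk⟩ := Real.Angle.angle_eq_iff_two_pi_dvd_sub.1 hθθ
  have hpi := Real.pi_pos
  simp only [Set.mem_Ioc] at hθ hθ'
  -- The two angles differ by `2πk` and both lie in one half-open period, which forces `k = 0`.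
  have hk1 : (k : ℝ) < 1 := by
    by_contra hc
    nlinarith [mul_le_mul_of_nonneg_left (not_lt.1 hc) (show 0 ≤ 2 * Real.pi by positivity)]
  have hk2 : (-1 : ℝ) < k := by
    by_contra hc
    nlinarith [mul_le_mul_of_nonneg_left (not_lt.1 hc) (show 0 ≤ 2 * Real.pi by positivity)]
  have hk0 : k = 0 := by
    have a1 : k < 1 := by exact_mod_cast hk1
    have a2 : -1 < k := by exact_mod_cast hk2
    omega
  rw [hk0] at hk
  simp at hk
  exact Prod.ext h3 (by linarith)

/-- By Lorentz invariance the left side is the product of `Λ(λ₃(t) r₃(θ)) q_r` with `a`. In the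
computation the light-cone coordinates `y 0 ± y 3` are scaled by `exp(∓t)` and `y 1 + i y 2` is
rotated; `q_r` sees only `y 0` and `y 1`. -/
lemma minkowskiProd_qPoint_lorentz (r t θ : ℝ) (a : Minkowski) :
    minkowskiProd (qPoint r) (lorentz (boostRot t θ)⁻¹ a)
      = ⟪momentum r (t, θ), WithLp.toLp 2 a⟫_ℝ := by
  rw [inner_momentum, boostRot_inv]
  set y := lorentz (boostRot (-t) (-θ)) a with hy
  have hH := toHerm_lorentz (boostRot (-t) (-θ)) a
  rw [← hy] at hH
  have e00 : toHerm y 0 0 = Real.exp (-t) * (a 0 + a 3 : ℝ) := by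
    rw [hH]
    simp [boostRot, toHerm, Matrix.mul_apply, Fin.sum_univ_two, ← Complex.exp_conj]
    rw [mul_right_comm, ← Complex.exp_add, show (starRingEnd ℂ) 2 = 2 from Complex.conj_ofReal 2]
    congr 2
    ring
  have e11 : toHerm y 1 1 = Real.exp t * (a 0 - a 3 : ℝ) := by
    rw [hH]
    simp [boostRot, toHerm, Matrix.mul_apply, Fin.sum_univ_two, ← Complex.exp_conj]
    rw [mul_right_comm, ← Complex.exp_add, show (starRingEnd ℂ) 2 = 2 from Complex.conj_ofReal 2]
    congr 2
    ring
  have e10 : toHerm y 1 0 = (Real.cos θ + Real.sin θ * Complex.I) * (a 1 + Complex.I * a 2) := by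
    rw [hH]
    simp [boostRot, toHerm, Matrix.mul_apply, Fin.sum_univ_two, ← Complex.exp_conj]
    rw [mul_right_comm, ← Complex.exp_add, show (starRingEnd ℂ) 2 = 2 from Complex.conj_ofReal 2,
      ← Complex.exp_mul_I]
    congr 2
    ring
  have f00 : y 0 + y 3 = Real.exp (-t) * (a 0 + a 3) := by
    have : (y 0 : ℂ) + y 3 = _ := e00
    exact_mod_cast this
  have f11 : y 0 - y 3 = Real.exp t * (a 0 - a 3) := by
    have : (y 0 : ℂ) - y 3 = _ := e11
    exact_mod_cast this
  have f10 : y 1 = Real.cos θ * a 1 - Real.sin θ * a 2 := by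
    have : (y 1 : ℂ) + Complex.I * y 2 = _ := e10
    have := congrArg Complex.re this
    simpa [-Complex.ofReal_cos, -Complex.ofReal_sin] using this
  simp [minkowskiProd, qPoint, f10, Real.cosh_eq, Real.sinh_eq]
  linear_combination (r / 2) * f00 + (r / 2) * f11

section Coordinates

variable {r : ℝ} {n : Fin 4}

variable (r n) in
/-- The equivariant functions on which `W_{r,n}` acts. -/
abbrev masslessSections :
    SectionSpace orbitMeasure (fun _ => ℂ) (equivariantFunctions (stabChar r n)) :=
  inducedSections (stabChar r n) orbitMeasure

/-- An equivariant function in the coordinates `(t, θ)`. -/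
def onStrip (f : equivariantFunctions (stabChar r n)) (z : ℝ × ℝ) : ℂ := f.1 (boostRotG z.1 z.2)

lemma measurable_boostRotG : Measurable fun z : ℝ × ℝ => boostRotG z.1 z.2 := by
  refine Continuous.measurable (Continuous.subtype_mk ?_ _)
  rw [continuous_poincare_iff]
  refine Continuous.prodMk continuous_const (Continuous.subtype_mk ?_ _)
  refine continuous_matrix fun i j => ?_
  fin_cases i <;> fin_cases j <;> simp <;> fun_prop

lemma measurable_onStrip (f : equivariantFunctions (stabChar r n)) : Measurable (onStrip f) :=
  f.2.1.comp measurable_boostRotG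

/-- A shift of `θ` by `2π` is right multiplication by `r₁(π)²`, which changes the function by the
sign `(-1)^n`. Only the modulus is therefore periodic in general. -/
lemma norm_onStrip_add_two_pi (f : equivariantFunctions (stabChar r n)) (t θ : ℝ) :
    ‖onStrip f (t, θ + 2 * Real.pi)‖ = ‖onStrip f (t, θ)‖ := by
  have h := coset_periodic t θ
  refine (norm_equivariant_out f _).symm.trans (Eq.trans ?_ (norm_equivariant_out f _))
  exact congrArg (fun x : Gt3 ⧸ stab => ‖f.1 x.out‖) h

/-- A square-integrable equivariant function in the coordinates `(t, θ)`. -/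
def stripFun (f : (masslessSections r n).PreL2) : ℝ × ℝ → ℂ := onStrip ((masslessSections r n).sec f)

lemma measurable_stripFun (f : (masslessSections r n).PreL2) : Measurable (stripFun f) :=
  measurable_onStrip _

lemma stripFun_sub (f g : (masslessSections r n).PreL2) (z : ℝ × ℝ) :
    stripFun (f - g) z = stripFun f z - stripFun g z := rfl

lemma stripFun_smul (c : ℂ) (f : (masslessSections r n).PreL2) (z : ℝ × ℝ) :
    stripFun (c • f) z = c * stripFun f z := rfl

lemma orbitMeasure_eq_map :
    orbitMeasure = stripMeasure.map fun z : ℝ × ℝ => coset z.1 z.2 := rfl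

lemma energy_eq_lintegral_strip (f : equivariantFunctions (stabChar r n)) :
    (inducedSections (stabChar r n) orbitMeasure).energy f
      = ∫⁻ z, ENNReal.ofReal (‖onStrip f z‖ ^ 2) ∂stripMeasure := by
  have hm : Measurable (fun x : Gt3 ⧸ stab => ENNReal.ofReal (‖f.1 x.out‖ ^ 2)) :=
    ((measurable_norm_out f).pow_const 2).ennreal_ofReal
  show ∫⁻ x, ENNReal.ofReal (‖f.1 x.out‖ ^ 2) ∂orbitMeasure = _
  rw [orbitMeasure_eq_map, lintegral_map hm measurable_coset]
  refine lintegral_congr fun z => ?_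
  rw [coset, norm_equivariant_out f]
  rfl

lemma ofReal_norm_sq_eq_lintegral_strip (f : (masslessSections r n).PreL2) :
    ENNReal.ofReal (‖f‖ ^ 2) = ∫⁻ z, ENNReal.ofReal (‖stripFun f z‖ ^ 2) ∂stripMeasure :=
  ((masslessSections r n).ofReal_norm_sq f).trans (energy_eq_lintegral_strip _)

/-- The chosen representative of a coset differs from `boostRotG` by an element of `stab`. The
resulting phase depends on `z` but not on `f`, so it cancels in inner products. -/
lemma ev_coset (z : ℝ × ℝ) : ∃ c : Circle, ∀ f : (masslessSections r n).PreL2,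
    (masslessSections r n).ev ((masslessSections r n).sec f) (coset z.1 z.2)
      = (c : ℂ) * stripFun f z := by
  obtain ⟨h, hh⟩ := QuotientGroup.mk_out_eq_mul stab (boostRotG z.1 z.2)
  refine ⟨(stabChar r n h)⁻¹, fun k => ?_⟩
  show ((masslessSections r n).sec k).1 (coset z.1 z.2).out = _
  rw [coset, hh, ((masslessSections r n).sec k).2.2]
  rfl

lemma inner_eq_integral_strip (f g : (masslessSections r n).PreL2) :
    (⟪f, g⟫_ℂ : ℂ) = ∫ z, (starRingEnd ℂ) (stripFun f z) * stripFun g z ∂stripMeasure := by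
  have hm := ((masslessSections r n).aemeasurable_inner ((masslessSections r n).sec f)
    ((masslessSections r n).sec g)).aestronglyMeasurable
  refine ((masslessSections r n).inner_def f g).trans
    ((integral_map measurable_coset.aemeasurable hm).trans ?_)
  refine integral_congr_ae (Eventually.of_forall fun z => ?_)
  obtain ⟨c, hc⟩ := ev_coset (r := r) (n := n) z
  have e2 : (starRingEnd ℂ) (c : ℂ) * (c : ℂ) = 1 := by
    rw [← Circle.coe_inv_eq_conj, ← Circle.coe_mul, inv_mul_cancel, Circle.coe_one]
  simp only [hc, RCLike.inner_apply, map_mul]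
  linear_combination ((starRingEnd ℂ) (stripFun f z) * stripFun g z) * e2

lemma integrable_stripFun_mul (f g : (masslessSections r n).PreL2) :
    Integrable (fun z => (starRingEnd ℂ) (stripFun f z) * stripFun g z) stripMeasure := by
  have h : ∀ k : (masslessSections r n).PreL2, MemLp (stripFun k) 2 stripMeasure := by
    intro k
    rw [memLp_two_iff_integrable_sq_norm (measurable_stripFun k).aestronglyMeasurable]
    refine ⟨((measurable_stripFun k).norm.pow_const 2).aestronglyMeasurable, ?_⟩
    rw [hasFiniteIntegral_iff_ofReal (Eventually.of_forall fun x => by positivity),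
      ← ofReal_norm_sq_eq_lintegral_strip]
    exact ENNReal.ofReal_lt_top
  exact (h f).star.integrable_mul (h g)

lemma mk_eq_mk_of_ae {f g : (masslessSections r n).PreL2}
    (h : ∀ᵐ z ∂stripMeasure, stripFun f z = stripFun g z) :
    (SeparationQuotient.mk f : InducedSpace (stabChar r n) orbitMeasure)
      = SeparationQuotient.mk g := by
  rw [← sub_eq_zero, ← SeparationQuotient.mk_sub, ← norm_eq_zero, SeparationQuotient.norm_mk]
  have h1 := ofReal_norm_sq_eq_lintegral_strip (f - g)
  have h2 : ∫⁻ z, ENNReal.ofReal (‖stripFun (f - g) z‖ ^ 2) ∂stripMeasure = 0 := by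
    refine lintegral_eq_zero_of_ae_eq_zero ?_
    filter_upwards [h] with z hz
    simp [stripFun_sub, hz]
  rw [h2, ENNReal.ofReal_eq_zero] at h1
  exact pow_eq_zero_iff two_ne_zero |>.1 (le_antisymm h1 (by positivity))

lemma ae_stripFun_eq_zero_iff {f : (masslessSections r n).PreL2} :
    (∀ᵐ z ∂stripMeasure, stripFun f z = 0) ↔
      (SeparationQuotient.mk f : InducedSpace (stabChar r n) orbitMeasure) = 0 := by
  refine ⟨fun h => mk_eq_mk_of_ae (g := 0) h, fun h => ?_⟩
  rw [← norm_eq_zero, SeparationQuotient.norm_mk] at h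
  have h1 := ofReal_norm_sq_eq_lintegral_strip f
  rw [h, eq_comm] at h1
  simp only [ne_eq, OfNat.ofNat_ne_zero, not_false_eq_true, zero_pow, ENNReal.ofReal_zero] at h1
  rw [lintegral_eq_zero_iff ((measurable_stripFun f).norm.pow_const 2).ennreal_ofReal] at h1
  filter_upwards [h1] with z hz
  have h2 : ‖stripFun f z‖ ^ 2 ≤ 0 := ENNReal.ofReal_eq_zero.1 hz
  exact norm_eq_zero.1 (pow_eq_zero_iff two_ne_zero |>.1 (le_antisymm h2 (by positivity)))

/-- The wide strip consists of three periods, and by periodicity of the modulus each contributes the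
same finite energy. This supplies the hypothesis of `tendsto_strip_translate`. -/
lemma lintegral_wide_strip_lt_top (f : (masslessSections r n).PreL2) :
    ∫⁻ z in Set.univ ×ˢ Set.Ioc (-(2 * Real.pi)) (4 * Real.pi),
      ENNReal.ofReal (‖stripFun f z‖ ^ 2) < ∞ := by
  have hpi := Real.pi_pos
  set k : ℝ × ℝ → ℝ≥0∞ := fun z => ENNReal.ofReal (‖stripFun f z‖ ^ 2) with hk
  have hper : ∀ z : ℝ × ℝ, k (z + (0, 2 * Real.pi)) = k z := by
    rintro ⟨t, θ⟩
    have h := norm_onStrip_add_two_pi ((masslessSections r n).sec f) t θ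
    simp only [hk, stripFun, Prod.mk_add_mk, add_zero, h]
  have hstep : ∀ c : ℝ, ∫⁻ z in Set.univ ×ˢ Set.Ioc c (c + 2 * Real.pi), k z
      = ∫⁻ z in Set.univ ×ˢ Set.Ioc (c + 2 * Real.pi) (c + 4 * Real.pi), k z := by
    intro c
    have hmp := measurePreserving_add_right (volume : Measure (ℝ × ℝ)) (0, 2 * Real.pi)
    have h := hmp.setLIntegral_comp_preimage_emb
      (MeasurableEquiv.addRight ((0, 2 * Real.pi) : ℝ × ℝ)).measurableEmbedding k
      (Set.univ ×ˢ Set.Ioc (c + 2 * Real.pi) (c + 4 * Real.pi))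
    rw [← h]
    simp only [hper]
    congr 2
    ext z
    simp only [Set.mem_prod, Set.mem_univ, true_and, Set.mem_Ioc, Set.mem_preimage, Prod.snd_add]
    constructor <;> rintro ⟨h1, h2⟩ <;> constructor <;> linarith
  have h0 : ∫⁻ z in Set.univ ×ˢ Set.Ioc 0 (0 + 2 * Real.pi), k z < ∞ := by
    rw [zero_add, ← stripMeasure_eq, hk, ← ofReal_norm_sq_eq_lintegral_strip]
    exact ENNReal.ofReal_lt_top
  have h1 := hstep 0
  have h2 := hstep (-(2 * Real.pi))
  rw [neg_add_cancel, show -(2 * Real.pi) + 4 * Real.pi = 0 + 2 * Real.pi by ring] at h2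
  have hsub : (Set.univ ×ˢ Set.Ioc (-(2 * Real.pi)) (4 * Real.pi) : Set (ℝ × ℝ))
      ⊆ (Set.univ ×ˢ Set.Ioc (-(2 * Real.pi)) 0 ∪ Set.univ ×ˢ Set.Ioc 0 (0 + 2 * Real.pi))
        ∪ Set.univ ×ˢ Set.Ioc (0 + 2 * Real.pi) (0 + 4 * Real.pi) := by
    rintro ⟨t, θ⟩ ⟨-, h3, h4⟩
    simp only [Set.mem_union, Set.mem_prod, Set.mem_univ, true_and, Set.mem_Ioc]
    simp only at h3 h4
    rcases le_or_gt θ 0 with h5 | h5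
    · exact Or.inl (Or.inl ⟨h3, h5⟩)
    · rcases le_or_gt θ (0 + 2 * Real.pi) with h6 | h6
      · exact Or.inl (Or.inr ⟨h5, h6⟩)
      · exact Or.inr ⟨h6, by linarith⟩
  refine (lintegral_mono_set hsub).trans_lt ((lintegral_union_le _ _ _).trans_lt ?_)
  refine ENNReal.add_lt_top.2 ⟨(lintegral_union_le _ _ _).trans_lt ?_, h1 ▸ h0⟩
  exact ENNReal.add_lt_top.2 ⟨h2 ▸ h0, h0⟩

/-- The existential hides the proof of square-integrability and keeps a formula valid at every `z`,
not merely almost everywhere. -/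
lemma exists_masslessRep_mk (g : Gt3) (f : (masslessSections r n).PreL2) :
    ∃ f' : (masslessSections r n).PreL2,
      masslessRep r n g (SeparationQuotient.mk f) = SeparationQuotient.mk f' ∧
      ∀ z, stripFun f' z = ((masslessSections r n).sec f).1 (g⁻¹ * boostRotG z.1 z.2) :=
  ⟨_, rfl, fun _ => rfl⟩

lemma exists_masslessRep_boostRotG (s : ℝ × ℝ) (f : (masslessSections r n).PreL2) :
    ∃ f' : (masslessSections r n).PreL2,
      masslessRep r n (boostRotG s.1 s.2) (SeparationQuotient.mk f) = SeparationQuotient.mk f' ∧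
      ∀ z, stripFun f' z = stripFun f (z - s) := by
  obtain ⟨f', h1, h2⟩ := exists_masslessRep_mk (boostRotG s.1 s.2) f
  refine ⟨f', h1, fun z => ?_⟩
  rw [h2, boostRotG_inv_mul]
  rfl

/-- A translation moved to the right past `λ₃(t) r₃(θ)` becomes the translation by `Λ⁻¹(-a)`, which
lies in `stab` and acts by the character. The minus sign in `-a` cancels the inverse in the
equivariance rule, so the exponent is positive. -/
lemma transG_inv_mul_boostRotG (a : Minkowski) (t θ : ℝ) :
    ∃ h : stab, (transG a)⁻¹ * boostRotG t θ = boostRotG t θ * h ∧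
      (((stabChar r n h)⁻¹ : Circle) : ℂ)
        = Complex.exp (⟪momentum r (t, θ), WithLp.toLp 2 a⟫_ℝ * Complex.I) := by
  set b := lorentz (boostRot t θ)⁻¹ (-a) with hb
  refine ⟨⟨transG b, one_mem (Subgroup.zpowers r1Pi)⟩, ?_, ?_⟩
  · rw [inv_mul_eq_iff_eq_mul]
    apply Subtype.ext
    refine SemidirectProduct.ext ?_ ?_
    · show (1 : Multiplicative Minkowski) = Multiplicative.ofAdd
        (a + lorentz 1 (0 + lorentz (boostRot t θ) b))
      rw [hb, lorentz_one, ← lorentz_mul, mul_inv_cancel, lorentz_one, zero_add, add_neg_cancel]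
      rfl
    · show boostRot t θ = 1 * (boostRot t θ * 1)
      rw [one_mul, mul_one]
  · have h1 : stabChar r n ⟨transG b, one_mem (Subgroup.zpowers r1Pi)⟩
        = translationChar (qPoint r) b := by
      show translationChar (qPoint r) b * littleChar n 1 = _
      rw [map_one, mul_one]
    rw [h1, translationChar, hb, minkowskiProd_qPoint_lorentz, ← Circle.exp_neg, Circle.coe_exp]
    simp

lemma exists_masslessRep_transG (a : Minkowski) (f : (masslessSections r n).PreL2) :
    ∃ f' : (masslessSections r n).PreL2,
      masslessRep r n (transG a) (SeparationQuotient.mk f) = SeparationQuotient.mk f' ∧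
      ∀ z, stripFun f' z
        = Complex.exp (⟪momentum r z, WithLp.toLp 2 a⟫_ℝ * Complex.I) * stripFun f z := by
  obtain ⟨f', h1, h2⟩ := exists_masslessRep_mk (transG a) f
  refine ⟨f', h1, fun z => ?_⟩
  obtain ⟨h, e1, e2⟩ := transG_inv_mul_boostRotG (r := r) (n := n) a z.1 z.2
  rw [h2, e1, ((masslessSections r n).sec f).2.2, e2]
  rfl

end Coordinates

/-! ### Irreducibility of `W_{r,n}` under translations, boosts and rotations -/

/-- Where `α z ≠ 0`, the quotient `β z / α z` is an eigenvalue of `S` at `x`, but the admissible `z`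
depend on `x`. Since `x` and the fixed nonzero `y` share an admissible `z`, the scalar at `x` equals
the scalar at `y`. -/
lemma exists_eq_smul_of_frequently {H Z : Type*} [NormedAddCommGroup H] [NormedSpace ℂ H]
    (S : H →L[ℂ] H) {y : H} (hy : y ≠ 0) {l : Filter Z} {α β : Z → ℂ} (hα : ∃ᶠ z in l, α z ≠ 0)
    (h : ∀ x, ∀ᶠ z in l, α z • S x = β z • x) : ∃ c : ℂ, ∀ x, S x = c • x := by
  have hdiv : ∀ z, α z ≠ 0 → ∀ x, α z • S x = β z • x → S x = ((α z)⁻¹ * β z) • x := by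
    intro z hz x hx
    rw [mul_smul, ← hx, smul_smul, inv_mul_cancel₀ hz, one_smul]
  obtain ⟨z₀, hz₀, h₀⟩ := (hα.and_eventually (h y)).exists
  refine ⟨(α z₀)⁻¹ * β z₀, fun x => ?_⟩
  obtain ⟨z, hz, h1, h2⟩ := (hα.and_eventually ((h x).and (h y))).exists
  have h3 := (hdiv z₀ hz₀ y h₀).symm.trans (hdiv z hz y h2)
  rw [hdiv z hz x h1, smul_left_injective ℂ hy h3]

section Irreducible

variable {r : ℝ} {n : Fin 4}

lemma boostRotG_add (s u : ℝ × ℝ) :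
    boostRotG (s.1 + u.1) (s.2 + u.2) = boostRotG s.1 s.2 * boostRotG u.1 u.2 := by
  rw [← inv_mul_eq_iff_eq_mul, boostRotG_inv_mul, add_sub_cancel_left, add_sub_cancel_left]

/-- The boosts and rotations act strongly continuously. -/
lemma continuous_masslessRep_boostRotG (x : InducedSpace (stabChar r n) orbitMeasure) :
    Continuous fun s : ℝ × ℝ => masslessRep r n (boostRotG s.1 s.2) x := by
  obtain ⟨f, rfl⟩ := SeparationQuotient.surjective_mk x
  have h0 : Tendsto (fun s : ℝ × ℝ => ‖masslessRep r n (boostRotG s.1 s.2) (SeparationQuotient.mk f)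
      - SeparationQuotient.mk f‖) (𝓝 0) (𝓝 0) := by
    have h1 := tendsto_strip_translate (measurable_stripFun f) (lintegral_wide_strip_lt_top f)
    have h2 := Real.continuous_sqrt.continuousAt.tendsto.comp
      ((ENNReal.tendsto_toReal ENNReal.zero_ne_top).comp h1)
    simp only [ENNReal.toReal_zero, Real.sqrt_zero] at h2
    refine h2.congr fun s => ?_
    obtain ⟨f', e1, e2⟩ := exists_masslessRep_boostRotG s f
    have h3 := ofReal_norm_sq_eq_lintegral_strip (f' - f)
    simp only [stripFun_sub, e2] at h3
    rw [e1, ← SeparationQuotient.mk_sub, SeparationQuotient.norm_mk, Function.comp_apply,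
      Function.comp_apply, ← h3, ENNReal.toReal_ofReal (by positivity), Real.sqrt_sq (norm_nonneg _)]
  rw [continuous_iff_continuousAt]
  intro s₀
  rw [ContinuousAt, tendsto_iff_norm_sub_tendsto_zero]
  have h4 : Tendsto (fun s : ℝ × ℝ => s - s₀) (𝓝 s₀) (𝓝 0) := by
    have : Continuous fun s : ℝ × ℝ => s - s₀ := by fun_prop
    simpa using this.tendsto s₀
  refine (h0.comp h4).congr fun s => ?_
  -- As the operators are isometries forming a group, continuity at `s₀` reduces to continuity at
  -- `0`.
  have e : boostRotG s.1 s.2 = boostRotG s₀.1 s₀.2 * boostRotG (s - s₀).1 (s - s₀).2 := by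
    rw [← boostRotG_add]
    simp
  have e2 : masslessRep r n (boostRotG s.1 s.2) (SeparationQuotient.mk f)
      = masslessRep r n (boostRotG s₀.1 s₀.2)
        (masslessRep r n (boostRotG (s - s₀).1 (s - s₀).2) (SeparationQuotient.mk f)) := by
    rw [e, map_mul]
    rfl
  rw [e2, ← map_sub, LinearIsometryEquiv.norm_map]
  rfl

lemma dense_range_ratCast_euclidean : Dense (Set.range fun q : Fin 4 → ℚ =>
    (WithLp.toLp 2 fun i => (q i : ℝ) : EuclideanSpace ℝ (Fin 4))) := by
  have h1 : DenseRange fun (q : Fin 4 → ℚ) (i : Fin 4) => (q i : ℝ) :=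
    DenseRange.piMap fun _ => Rat.denseRange_cast
  exact DenseRange.comp (g := (WithLp.toLp 2 : (Fin 4 → ℝ) → EuclideanSpace ℝ (Fin 4)))
    (WithLp.toLp_surjective 2).denseRange h1 (PiLp.continuous_toLp 2 _)

/-- The kernel identity: if `S` commutes with translations, boosts and rotations, then
`conj (y z) • S x = conj ((S* y) z) • x` for almost every `z`. -/
lemma ae_smul_eq_smul_of_commute (hr : 0 < r)
    (S : InducedSpace (stabChar r n) orbitMeasure →L[ℂ] InducedSpace (stabChar r n) orbitMeasure)
    (hT : ∀ (q : Fin 4 → ℚ) x, S (masslessRep r n (transG fun i => q i) x)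
      = masslessRep r n (transG fun i => q i) (S x))
    (hB : ∀ (s : ℝ × ℝ) x, S (masslessRep r n (boostRotG s.1 s.2) x)
      = masslessRep r n (boostRotG s.1 s.2) (S x))
    (y y' : (masslessSections r n).PreL2)
    (hy : ContinuousLinearMap.adjoint S (SeparationQuotient.mk y) = SeparationQuotient.mk y')
    (x : InducedSpace (stabChar r n) orbitMeasure) :
    ∀ᵐ z ∂stripMeasure,
      (starRingEnd ℂ) (stripFun y z) • S x = (starRingEnd ℂ) (stripFun y' z) • x := by
  obtain ⟨f, rfl⟩ := SeparationQuotient.surjective_mk x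
  obtain ⟨f', hf'⟩ := SeparationQuotient.surjective_mk (S (SeparationQuotient.mk f))
  -- For fixed `s`, commutation equates the matrix coefficients of all rational translations. These
  -- are Fourier transforms along the injective map `momentum r`, so the integrands agree almost
  -- everywhere.
  have key : ∀ s : ℝ × ℝ, ∀ᵐ z ∂stripMeasure,
      (starRingEnd ℂ) (stripFun y' z) * stripFun f (z - s)
        = (starRingEnd ℂ) (stripFun y z) * stripFun f' (z - s) := by
    intro s
    obtain ⟨k, hk1, hk2⟩ := exists_masslessRep_boostRotG s f
    obtain ⟨k', hk1', hk2'⟩ := exists_masslessRep_boostRotG s f'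
    have hI := (integrable_stripFun_mul y' k).sub (integrable_stripFun_mul y k')
    have hz := ae_eq_zero_of_integral_exp_inner_dense (measurable_momentum r)
      (MeasurableSet.univ.prod measurableSet_Ioc)
      (by rw [stripMeasure_eq]; exact ae_restrict_mem (MeasurableSet.univ.prod measurableSet_Ioc))
      (injOn_momentum hr) hI dense_range_ratCast_euclidean (by
        rintro _ ⟨q, rfl⟩
        obtain ⟨m, hm1, hm2⟩ := exists_masslessRep_transG (fun i => (q i : ℝ)) k
        obtain ⟨m', hm1', hm2'⟩ := exists_masslessRep_transG (fun i => (q i : ℝ)) k'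
        have h1 : (⟪(SeparationQuotient.mk y' : InducedSpace (stabChar r n) orbitMeasure),
            SeparationQuotient.mk m⟫_ℂ : ℂ)
            = ⟪(SeparationQuotient.mk y : InducedSpace (stabChar r n) orbitMeasure),
              SeparationQuotient.mk m'⟫_ℂ := by
          rw [← hy, ContinuousLinearMap.adjoint_inner_left, ← hm1, hT, ← hk1, hB, ← hf', hk1', hm1']
        rw [SeparationQuotient.inner_mk_mk, SeparationQuotient.inner_mk_mk] at h1
        rw [inner_eq_integral_strip, inner_eq_integral_strip, ← sub_eq_zero,
          ← integral_sub (integrable_stripFun_mul y' m) (integrable_stripFun_mul y m')] at h1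
        rw [← h1]
        refine integral_congr_ae (Eventually.of_forall fun z => ?_)
        simp only [Pi.sub_apply, hm2, hm2']
        ring)
    filter_upwards [hz] with z hz
    simp only [Pi.sub_apply, Pi.zero_apply, hk2, hk2'] at hz
    exact sub_eq_zero.1 hz
  have hmeas : MeasurableSet {q : (ℝ × ℝ) × (ℝ × ℝ) |
      (starRingEnd ℂ) (stripFun y' q.2) * stripFun f (q.2 - q.1)
        = (starRingEnd ℂ) (stripFun y q.2) * stripFun f' (q.2 - q.1)} := by
    have hc : Measurable (starRingEnd ℂ) := Complex.continuous_conj.measurable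
    have hd : Measurable fun q : (ℝ × ℝ) × (ℝ × ℝ) => q.2 - q.1 := by fun_prop
    refine measurableSet_eq_fun ?_ ?_
    · exact (hc.comp ((measurable_stripFun y').comp measurable_snd)).mul
        ((measurable_stripFun f).comp hd)
    · exact (hc.comp ((measurable_stripFun y).comp measurable_snd)).mul
        ((measurable_stripFun f').comp hd)
  -- Fubini exchanges the quantifiers: for almost every `z`, the identity holds for almost every
  -- `s`.
  have hswap := (Measure.ae_ae_comm (μ := (volume : Measure (ℝ × ℝ))) (ν := stripMeasure) hmeas).1
    (Eventually.of_forall key)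
  filter_upwards [hswap] with z hz
  rw [← hf', ← SeparationQuotient.mk_smul, ← SeparationQuotient.mk_smul]
  refine mk_eq_mk_of_ae ?_
  -- With `z` frozen, the substitution `u = z - s` makes the two sides functions of `u`, that is,
  -- multiples of the vectors `x` and `S x`.
  have h1 := (Measure.measurePreserving_sub_left (volume : Measure (ℝ × ℝ)) z).quasiMeasurePreserving.ae hz
  rw [stripMeasure_eq]
  refine ae_restrict_of_ae ?_
  filter_upwards [h1] with u hu
  rw [stripFun_smul, stripFun_smul]
  simpa using hu.symm

/-- A bounded operator that commutes with the rational translations, boosts and rotations in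
`W_{r,n}` is a scalar. -/
lemma exists_eq_smul_of_commute (hr : 0 < r)
    (S : InducedSpace (stabChar r n) orbitMeasure →L[ℂ] InducedSpace (stabChar r n) orbitMeasure)
    (hT : ∀ (q : Fin 4 → ℚ) x, S (masslessRep r n (transG fun i => q i) x)
      = masslessRep r n (transG fun i => q i) (S x))
    (hB : ∀ (s : ℚ × ℚ) x, S (masslessRep r n (boostRotG s.1 s.2) x)
      = masslessRep r n (boostRotG s.1 s.2) (S x)) :
    ∃ c : ℂ, ∀ x, S x = c • x := by
  -- Strong continuity extends commutation from rational to real parameters, as needed for Fubini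
  -- over all shifts.
  have hB' : ∀ (s : ℝ × ℝ) x, S (masslessRep r n (boostRotG s.1 s.2) x)
      = masslessRep r n (boostRotG s.1 s.2) (S x) := by
    intro s x
    have hd : DenseRange fun q : ℚ × ℚ => ((q.1 : ℝ), (q.2 : ℝ)) :=
      Rat.denseRange_cast.prodMap Rat.denseRange_cast
    refine congrFun (hd.equalizer (S.continuous.comp (continuous_masslessRep_boostRotG x))
      (continuous_masslessRep_boostRotG (S x)) (funext fun q => ?_)) s
    exact hB q x
  -- On the zero space every scalar works, so nontriviality of the representation space need not be
  -- established.
  by_cases hK : ∃ y₀ : InducedSpace (stabChar r n) orbitMeasure, y₀ ≠ 0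
  · obtain ⟨y₀, hy₀⟩ := hK
    obtain ⟨y, rfl⟩ := SeparationQuotient.surjective_mk y₀
    obtain ⟨y', hy'⟩ := SeparationQuotient.surjective_mk
      (ContinuousLinearMap.adjoint S (SeparationQuotient.mk y))
    have hae := ae_smul_eq_smul_of_commute hr S hT hB' y y' hy'.symm
    have hfreq : ∃ᵐ z ∂stripMeasure, stripFun y z ≠ 0 := fun h => hy₀ <|
      ae_stripFun_eq_zero_iff.1 (h.mono fun z hz => not_not.1 hz)
    exact exists_eq_smul_of_frequently S hy₀
      (hfreq.mono fun z hz => (map_ne_zero (starRingEnd ℂ)).2 hz) hae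
  · have h0 : ∀ y : InducedSpace (stabChar r n) orbitMeasure, y = 0 := fun y => by
      by_contra hy
      exact hK ⟨y, hy⟩
    exact ⟨0, fun x => (h0 _).trans (h0 _).symm⟩

end Irreducible

/-! ### Multiples of a representation and commutants -/

section Commutants

variable {G : Type*} [Group G] {H K : Type*} [NormedAddCommGroup H] [InnerProductSpace ℂ H]
  [NormedAddCommGroup K] [InnerProductSpace ℂ K]

lemma UnitaryRep.mul_apply (U : UnitaryRep G H) (g h : G) (x : H) : U (g * h) x = U g (U h x) := by
  rw [map_mul]
  rfl

lemma UnitaryRep.inner_apply_right (U : UnitaryRep G H) (g : G) (x y : H) :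
    (⟪x, U g y⟫_ℂ : ℂ) = ⟪U g⁻¹ x, y⟫_ℂ := by
  rw [← LinearIsometryEquiv.inner_map_map (U g⁻¹) x, ← U.mul_apply, inv_mul_cancel, map_one]
  rfl

/-- Every bounded operator that commutes with `U(h)` for `h ∈ S` commutes with `U(w)`. -/
def CommutantFixes (U : UnitaryRep G H) (S : Set G) (w : G) : Prop :=
  ∀ T : H →L[ℂ] H, (∀ h ∈ S, ∀ x, T (U h x) = U h (T x)) → ∀ x, T (U w x) = U w (T x)

/-- On a direct sum of copies of `K`, an operator is a matrix of operators on `K`. If it commutes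
with the diagonal action of `S`, each block commutes with `W` on `S`, hence with `W w`. -/
lemma CommutantFixes.of_isMultipleOf {U : UnitaryRep G H} {W : UnitaryRep G K} {S : Set G} {w : G}
    (hW : CommutantFixes W S w) (hU : U.IsMultipleOf W) : CommutantFixes U S w := by
  classical
  obtain ⟨ι, V, hV⟩ := hU
  intro T hT
  let inj : ι → K →L[ℂ] H := fun i =>
    V.symm.toContinuousLinearEquiv.toContinuousLinearMap ∘L
      lp.singleContinuousLinearMap ℂ (fun _ : ι => K) 2 i
  let ev : ι → H →L[ℂ] K := fun i =>
    lp.evalCLM ℂ (fun _ : ι => K) 2 i ∘L V.toContinuousLinearEquiv.toContinuousLinearMap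
  have hinj : ∀ g i x, inj i (W g x) = U g (inj i x) := by
    intro g i x
    refine V.injective (lp.ext (funext fun j => ?_))
    rw [hV]
    show V (V.symm (lp.single 2 i (W g x))) j = W g (V (V.symm (lp.single 2 i x)) j)
    rw [V.apply_symm_apply, V.apply_symm_apply]
    by_cases hij : j = i
    · subst hij
      rw [lp.single_apply_self, lp.single_apply_self]
    · rw [lp.single_apply_ne _ _ _ hij, lp.single_apply_ne _ _ _ hij, map_zero]
  have hev : ∀ g i x, ev i (U g x) = W g (ev i x) := fun g i x => hV g x i
  have hblock : ∀ i j x, ev j (T (inj i (W w x))) = ev j (U w (T (inj i x))) := by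
    intro i j x
    rw [hev]
    refine hW (ev j ∘L T ∘L inj i) (fun h hh y => ?_) x
    show ev j (T (inj i (W h y))) = W h (ev j (T (inj i y)))
    rw [hinj, hT h hh, hev]
  have hsingle : ∀ i x, T (U w (inj i x)) = U w (T (inj i x)) := by
    intro i x
    refine V.injective (lp.ext (funext fun j => ?_))
    rw [← hinj]
    exact hblock i j x
  -- Vectors supported on a single summand span a dense subspace because the exponent `2` is finite;
  -- by continuity it is enough to compare the operators there.
  have hext : (T ∘L U.op w) ∘L V.symm.toContinuousLinearEquiv.toContinuousLinearMap
      = (U.op w ∘L T) ∘L V.symm.toContinuousLinearEquiv.toContinuousLinearMap :=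
    lp.ext_continuousLinearMap (by simp) fun i => ContinuousLinearMap.ext fun x => hsingle i x
  intro x
  have h1 := DFunLike.congr_fun hext (V x)
  have h2 : V.symm (V x) = x := V.symm_apply_apply x
  change T (U w (V.symm (V x))) = U w (T (V.symm (V x))) at h1
  rwa [h2] at h1

/-- The direct sum of two copies of `U`. -/
def doubleRep (U : UnitaryRep G H) : UnitaryRep G (PiLp 2 fun _ : Fin 2 => H) where
  toFun g := LinearIsometryEquiv.piLpCongrRight 2 fun _ => U g
  map_one' := by
    ext x i
    simp
  map_mul' g h := by
    ext x i
    simp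

lemma doubleRep_isMultipleOf (U : UnitaryRep G H) : (doubleRep U).IsMultipleOf U :=
  ⟨Fin 2, (lpPiLpₗᵢ (p := 2) (fun _ : Fin 2 => H) ℂ).symm, fun _ _ _ => rfl⟩

/-- A closed subspace invariant under `U(h)` for `h` in a subgroup is invariant under `U(w)`. -/
lemma CommutantFixes.mem_of_invariant [CompleteSpace H] {U : UnitaryRep G H} {S : Subgroup G} {w : G}
    (hU : CommutantFixes U S w) (L : Submodule ℂ H) (hL : IsClosed (L : Set H))
    (hinv : ∀ h ∈ S, ∀ x ∈ L, U h x ∈ L) {x : H} (hx : x ∈ L) : U w x ∈ L := by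
  have : CompleteSpace L := hL.completeSpace_coe
  -- The projection onto `L` commutes with `U h`: the component in `L` stays there by invariance
  -- under `h`, and the orthogonal component stays orthogonal by invariance under `h⁻¹`.
  have h1 := hU L.starProjection (fun h hh y => by
    refine Submodule.eq_starProjection_of_mem_orthogonal' (z := U h (y - L.starProjection y))
      (hinv h hh _ (Submodule.starProjection_apply_mem L y)) ?_ (by simp)
    intro l hl
    rw [U.inner_apply_right]
    exact L.sub_starProjection_mem_orthogonal y _ (hinv h⁻¹ (inv_mem hh) l hl)) x
  rw [Submodule.starProjection_eq_self_iff.2 hx] at h1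
  exact Submodule.starProjection_eq_self_iff.1 h1

/-- An identity between matrix coefficients that holds on a subgroup holds at `w`. -/
lemma CommutantFixes.inner_eq_inner [CompleteSpace H] {U : UnitaryRep G H} {S : Subgroup G} {w : G}
    (hU : CommutantFixes U S w) {a b c d : H}
    (h : ∀ k ∈ S, (⟪a, U k b⟫_ℂ : ℂ) = ⟪c, U k d⟫_ℂ) : (⟪a, U w b⟫_ℂ : ℂ) = ⟪c, U w d⟫_ℂ := by
  -- In `H ⊕ H` the hypothesis says that the orbit of `(b, d)` under the subgroup is orthogonal to
  -- `(a, -c)`.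
  let v : PiLp 2 fun _ : Fin 2 => H := !₂[b, d]
  let v' : PiLp 2 fun _ : Fin 2 => H := !₂[a, -c]
  have hv : ∀ k, (⟪v', doubleRep U k v⟫_ℂ : ℂ) = ⟪a, U k b⟫_ℂ - ⟪c, U k d⟫_ℂ := by
    intro k
    simp [v, v', doubleRep, PiLp.inner_apply, sub_eq_add_neg]
  let L₀ : Submodule ℂ (PiLp 2 fun _ : Fin 2 => H) :=
    Submodule.span ℂ (Set.range fun k : S => doubleRep U (k : G) v)
  have hL₀ : ∀ k ∈ S, ∀ x ∈ L₀, doubleRep U k x ∈ L₀ := by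
    intro k hk x hx
    induction hx using Submodule.span_induction with
    | mem x hx =>
      obtain ⟨l, rfl⟩ := hx
      refine Submodule.subset_span ⟨⟨k * l, mul_mem hk l.2⟩, ?_⟩
      exact (doubleRep U).mul_apply k l v
    | zero => simp
    | add x y _ _ hx hy => rw [map_add]; exact add_mem hx hy
    | smul c x _ hx => rw [map_smul]; exact Submodule.smul_mem _ _ hx
  -- The closed span of the orbit is invariant under the subgroup and contains `v`. The doubled
  -- representation is again a multiple of `U`, so the span also contains the image of `v` under
  -- `w`.
  have hmem := (hU.of_isMultipleOf (doubleRep_isMultipleOf U)).mem_of_invariant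
    L₀.topologicalClosure L₀.isClosed_topologicalClosure (fun k hk x hx => by
      exact map_mem_closure (doubleRep U k).continuous hx (hL₀ k hk))
    (L₀.le_topologicalClosure (Submodule.subset_span ⟨1, by simp⟩ : v ∈ L₀))
  have horth : L₀.topologicalClosure ≤ (ℂ ∙ v')ᗮ := by
    refine L₀.topologicalClosure_minimal ?_ (Submodule.isClosed_orthogonal _)
    rw [Submodule.span_le]
    rintro _ ⟨k, rfl⟩
    refine Submodule.mem_orthogonal_singleton_iff_inner_right.2 ?_
    rw [hv, h k k.2, sub_self]
  have h1 := Submodule.mem_orthogonal_singleton_iff_inner_right.1 (horth hmem)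
  rw [hv] at h1
  exact sub_eq_zero.1 h1

end Commutants

/-! ### Averages over spatial translations -/

section Walk

variable {G : Type*} [Group G] {H K : Type*} [NormedAddCommGroup H] [InnerProductSpace ℂ H]
  [NormedAddCommGroup K] [InnerProductSpace ℂ K]

/-- The average of `U(a)`, `U(a⁻¹)`, `U(b)` and `U(b⁻¹)`. -/
def walk (U : UnitaryRep G H) (a b : G) : H →L[ℂ] H :=
  (1 / 4 : ℂ) • (U.op a + U.op a⁻¹ + U.op b + U.op b⁻¹)

lemma walk_apply (U : UnitaryRep G H) (a b : G) (x : H) :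
    walk U a b x = (1 / 4 : ℂ) • (U a x + U a⁻¹ x + U b x + U b⁻¹ x) := rfl

lemma norm_walk_apply_le (U : UnitaryRep G H) (a b : G) (x : H) : ‖walk U a b x‖ ≤ ‖x‖ := by
  rw [walk_apply, norm_smul]
  have h := norm_add₄_le (a := U a x) (b := U a⁻¹ x) (c := U b x) (d := U b⁻¹ x)
  simp only [LinearIsometryEquiv.norm_map] at h
  rw [show ‖(1 / 4 : ℂ)‖ = 1 / 4 by norm_num]
  linarith

lemma norm_pow_apply_le {A : H →L[ℂ] H} (hA : ∀ x, ‖A x‖ ≤ ‖x‖) (k : ℕ) (x : H) :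
    ‖(A ^ k) x‖ ≤ ‖x‖ := by
  induction k with
  | zero => simp
  | succ k ih =>
    rw [pow_succ']
    exact (hA _).trans ih

/-- Powers of a contraction that is close to a scalar are close to the powers of the scalar. -/
lemma norm_pow_sub_smul_le {A : H →L[ℂ] H} (hA : ∀ x, ‖A x‖ ≤ ‖x‖) {c : ℂ} (hc : ‖c‖ ≤ 1) {δ : ℝ}
    (h : ∀ x, ‖A x - c • x‖ ≤ δ * ‖x‖) (k : ℕ) (x : H) :
    ‖(A ^ k) x - c ^ k • x‖ ≤ k * δ * ‖x‖ := by
  induction k with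
  | zero => simp
  | succ k ih =>
    -- Telescoping: one new error passes through the contraction `A ^ k`, while the previous error
    -- is multiplied by `c` with `‖c‖ ≤ 1`. Errors thus only add up.
    have e : (A ^ (k + 1)) x - c ^ (k + 1) • x
        = (A ^ k) (A x - c • x) + c • ((A ^ k) x - c ^ k • x) := by
      rw [pow_succ, pow_succ', map_sub, map_smul, smul_sub, smul_smul]
      show (A ^ k) (A x) - _ = _
      abel
    rw [e]
    refine (norm_add_le _ _).trans ?_
    have h1 := (norm_pow_apply_le hA k (A x - c • x)).trans (h x)
    have h2 : ‖c • ((A ^ k) x - c ^ k • x)‖ ≤ k * δ * ‖x‖ := by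
      rw [norm_smul]
      exact (mul_le_of_le_one_left (norm_nonneg _) hc).trans ih
    rw [Nat.cast_succ, add_mul, add_mul, one_mul]
    linarith

/-- The walk acts coordinate by coordinate in a multiple, and the norm of the direct sum is monotone
in the norms of the coordinates. -/
lemma norm_walk_sub_smul_le_of_isMultipleOf {U : UnitaryRep G H} {W : UnitaryRep G K}
    (hU : U.IsMultipleOf W) {a b : G} {c : ℂ} {δ : ℝ} (hδ : 0 ≤ δ)
    (h : ∀ x, ‖walk W a b x - c • x‖ ≤ δ * ‖x‖) (x : H) :
    ‖walk U a b x - c • x‖ ≤ δ * ‖x‖ := by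
  obtain ⟨ι, V, hV⟩ := hU
  have h1 : ∀ i, V (walk U a b x - c • x) i = walk W a b (V x i) - c • V x i := by
    intro i
    simp only [walk_apply, map_sub, map_smul, map_add, lp.coeFn_sub, lp.coeFn_smul, lp.coeFn_add,
      Pi.sub_apply, Pi.smul_apply, Pi.add_apply, hV]
  have h2 : ‖V (walk U a b x - c • x)‖ ≤ ‖(δ : ℂ) • V x‖ := by
    refine lp.norm_mono (by simp) fun i => ?_
    rw [h1, lp.coeFn_smul, Pi.smul_apply, norm_smul, Complex.norm_real, Real.norm_of_nonneg hδ]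
    exact h _
  rwa [V.norm_map, norm_smul, Complex.norm_real, Real.norm_of_nonneg hδ, V.norm_map] at h2

end Walk

/-- Both expressions are `1 - y²/4 + O(y⁴)`: the angle drops out at second order because `cos² θ +
sin² θ = 1`. A quartic error is small enough to survive of the order of `1/y²` steps of the walk. -/
lemma abs_cos_average_sub_exp_le {y θ : ℝ} (hy : |y| ≤ 1) :
    |(Real.cos (y * Real.cos θ) + Real.cos (y * Real.sin θ)) / 2 - Real.exp (-(y ^ 2 / 4))|
      ≤ y ^ 4 := by
  -- The constant `5/96` is that of `Real.cos_bound`. Together with the exponential error `y⁴/16`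
  -- the total is `11/96 * y⁴`, well below `y⁴`.
  have hb : ∀ c : ℝ, |c| ≤ 1 →
      |Real.cos (y * c) - (1 - (y * c) ^ 2 / 2)| ≤ y ^ 4 * (5 / 96) := by
    intro c hc
    have h1 : |y * c| ≤ |y| := by
      rw [abs_mul]
      exact mul_le_of_le_one_right (abs_nonneg _) hc
    refine (Real.cos_bound (h1.trans hy)).trans ?_
    have h2 : |y * c| ^ 4 ≤ |y| ^ 4 := pow_le_pow_left₀ (abs_nonneg _) h1 4
    rw [show |y| ^ 4 = y ^ 4 from (even_two_mul 2).pow_abs y] at h2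
    linarith
  have h1 := hb _ (Real.abs_cos_le_one θ)
  have h2 := hb _ (Real.abs_sin_le_one θ)
  have hy2 : y ^ 2 ≤ 1 := (sq_le_one_iff_abs_le_one y).2 hy
  have h3 := Real.abs_exp_sub_one_sub_id_le (x := -(y ^ 2 / 4)) (by
    rw [abs_neg, abs_of_nonneg (by positivity)]
    linarith)
  have h4 := Real.sin_sq_add_cos_sq θ
  have h5 : (y * Real.cos θ) ^ 2 + (y * Real.sin θ) ^ 2 = y ^ 2 := by
    linear_combination y ^ 2 * h4
  have h6 : (-(y ^ 2 / 4)) ^ 2 = y ^ 4 / 16 := by ring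
  have h7 : 0 ≤ y ^ 4 := by positivity
  rw [h6] at h3
  rw [abs_le] at h1 h2 h3 ⊢
  constructor <;> linarith [h1.1, h1.2, h2.1, h2.2, h3.1, h3.2]

lemma transG_inv (a : Minkowski) : (transG a)⁻¹ = transG (-a) := by
  rw [inv_eq_iff_mul_eq_one]
  apply Subtype.ext
  show SemidirectProduct.inl (Multiplicative.ofAdd a) * SemidirectProduct.inl (Multiplicative.ofAdd (-a))
    = (1 : Poincare)
  rw [← map_mul, ← ofAdd_add, add_neg_cancel, ofAdd_zero, map_one]

lemma norm_mk_le_of_stripFun {r : ℝ} {n : Fin 4} {k f : (masslessSections r n).PreL2} {δ : ℝ}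
    (hδ : 0 ≤ δ) (h : ∀ z, ‖stripFun k z‖ ≤ δ * ‖stripFun f z‖) :
    ‖(SeparationQuotient.mk k : InducedSpace (stabChar r n) orbitMeasure)‖
      ≤ δ * ‖(SeparationQuotient.mk f : InducedSpace (stabChar r n) orbitMeasure)‖ := by
  rw [SeparationQuotient.norm_mk, SeparationQuotient.norm_mk]
  have hle : ENNReal.ofReal (‖k‖ ^ 2) ≤ ENNReal.ofReal ((δ * ‖f‖) ^ 2) := by
    rw [mul_pow, ENNReal.ofReal_mul (by positivity), ofReal_norm_sq_eq_lintegral_strip,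
      ofReal_norm_sq_eq_lintegral_strip, ← lintegral_const_mul' _ _ (by simp)]
    refine lintegral_mono fun z => ?_
    rw [← ENNReal.ofReal_mul (by positivity), ← mul_pow]
    exact ENNReal.ofReal_le_ofReal (pow_le_pow_left₀ (norm_nonneg _) (h z) 2)
  rw [ENNReal.ofReal_le_ofReal_iff (by positivity)] at hle
  exact (sq_le_sq₀ (norm_nonneg _) (by positivity)).1 hle

/-- This is the multiplier of the walk on the strip. Translations along the axes 1 and 2 see only
the components `-r cos θ` and `r sin θ`, so the boost parameter does not occur. -/
lemma average_exp_momentum (r ε : ℝ) (z : ℝ × ℝ) :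
    1 / 4 * (Complex.exp (⟪momentum r z, WithLp.toLp 2 (Pi.single 1 ε : Minkowski)⟫_ℝ * Complex.I)
      + Complex.exp (⟪momentum r z, WithLp.toLp 2 (-Pi.single 1 ε : Minkowski)⟫_ℝ * Complex.I)
      + Complex.exp (⟪momentum r z, WithLp.toLp 2 (Pi.single 2 ε : Minkowski)⟫_ℝ * Complex.I)
      + Complex.exp (⟪momentum r z, WithLp.toLp 2 (-Pi.single 2 ε : Minkowski)⟫_ℝ * Complex.I))
    = (((Real.cos (ε * r * Real.cos z.2) + Real.cos (ε * r * Real.sin z.2)) / 2 : ℝ) : ℂ) := by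
  have h1 : ⟪momentum r z, WithLp.toLp 2 (Pi.single 1 ε : Minkowski)⟫_ℝ
      = -(ε * r * Real.cos z.2) := by
    rw [inner_momentum]; simp; ring
  have h2 : ⟪momentum r z, WithLp.toLp 2 (-Pi.single 1 ε : Minkowski)⟫_ℝ
      = ε * r * Real.cos z.2 := by
    rw [inner_momentum]; simp; ring
  have h3 : ⟪momentum r z, WithLp.toLp 2 (Pi.single 2 ε : Minkowski)⟫_ℝ
      = ε * r * Real.sin z.2 := by
    rw [inner_momentum]; simp; ring
  have h4 : ⟪momentum r z, WithLp.toLp 2 (-Pi.single 2 ε : Minkowski)⟫_ℝ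
      = -(ε * r * Real.sin z.2) := by
    rw [inner_momentum]; simp; ring
  rw [h1, h2, h3, h4, Complex.ofReal_div, Complex.ofReal_add, Complex.ofReal_cos (ε * r * _),
    Complex.ofReal_cos (ε * r * _), Complex.cos, Complex.cos, Complex.ofReal_neg, Complex.ofReal_neg,
    Complex.ofReal_ofNat]
  ring

/-- The walk is multiplication by a function of `θ` that lies uniformly close to a constant
depending only on `ε r`; a uniform bound on multipliers is a bound in norm. -/
lemma norm_walk_masslessRep_sub_smul_le {r ε : ℝ} (n : Fin 4) (h : |ε * r| ≤ 1)
    (x : InducedSpace (stabChar r n) orbitMeasure) :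
    ‖walk (masslessRep r n) (transG (Pi.single 1 ε)) (transG (Pi.single 2 ε)) x
      - (Real.exp (-((ε * r) ^ 2 / 4)) : ℂ) • x‖ ≤ (ε * r) ^ 4 * ‖x‖ := by
  obtain ⟨f, rfl⟩ := SeparationQuotient.surjective_mk x
  obtain ⟨f1, e1, h1⟩ := exists_masslessRep_transG (Pi.single 1 ε) f
  obtain ⟨f2, e2, h2⟩ := exists_masslessRep_transG (-Pi.single 1 ε) f
  obtain ⟨f3, e3, h3⟩ := exists_masslessRep_transG (Pi.single 2 ε) f
  obtain ⟨f4, e4, h4⟩ := exists_masslessRep_transG (-Pi.single 2 ε) f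
  have hmk : walk (masslessRep r n) (transG (Pi.single 1 ε)) (transG (Pi.single 2 ε))
        (SeparationQuotient.mk f)
      - (Real.exp (-((ε * r) ^ 2 / 4)) : ℂ) • SeparationQuotient.mk f
      = SeparationQuotient.mk ((1 / 4 : ℂ) • (f1 + f2 + f3 + f4)
        - (Real.exp (-((ε * r) ^ 2 / 4)) : ℂ) • f) := by
    rw [walk_apply, transG_inv, transG_inv]
    exact congrArg (fun v => (1 / 4 : ℂ) • v - (Real.exp (-((ε * r) ^ 2 / 4)) : ℂ) •
        (SeparationQuotient.mk f : InducedSpace (stabChar r n) orbitMeasure))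
      (congrArg₂ (· + ·) (congrArg₂ (· + ·) (congrArg₂ (· + ·) e1 e2) e3) e4)
  rw [hmk]
  refine norm_mk_le_of_stripFun (by positivity) fun z => ?_
  have e : stripFun ((1 / 4 : ℂ) • (f1 + f2 + f3 + f4)
      - (Real.exp (-((ε * r) ^ 2 / 4)) : ℂ) • f) z
      = 1 / 4 * (stripFun f1 z + stripFun f2 z + stripFun f3 z + stripFun f4 z)
        - (Real.exp (-((ε * r) ^ 2 / 4)) : ℂ) * stripFun f z := rfl
  rw [e, h1, h2, h3, h4, ← add_mul, ← add_mul, ← add_mul, ← mul_assoc, average_exp_momentum,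
    ← sub_mul, ← Complex.ofReal_sub, norm_mul, Complex.norm_real]
  exact mul_le_mul_of_nonneg_right (abs_cos_average_sub_exp_le h) (norm_nonneg _)

/-! ### Matrix coefficients of direct integrals -/

namespace MeasurableField

variable {X : Type*} [MeasurableSpace X] {μ : Measure X} {E : X → Type*}
  [∀ x, NormedAddCommGroup (E x)] [∀ x, InnerProductSpace ℂ (E x)] {𝓔 : MeasurableField μ E}
  {G : Type*} [Group G]

/-- The value at `x` of a square-integrable measurable vector field. -/
def eval (s : 𝓔.sectionSpace.PreL2) (x : X) : E x :=
  𝓔.sectionSpace.ev (𝓔.sectionSpace.sec s) x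

lemma inner_mk_mk (s t : 𝓔.sectionSpace.PreL2) :
    (⟪(SeparationQuotient.mk s : 𝓔.directIntegral), SeparationQuotient.mk t⟫_ℂ : ℂ)
      = ∫ x, (⟪eval s x, eval t x⟫_ℂ : ℂ) ∂μ :=
  SeparationQuotient.inner_mk_mk s t

lemma integrable_inner_eval (s t : 𝓔.sectionSpace.PreL2) :
    Integrable (fun x => (⟪eval s x, eval t x⟫_ℂ : ℂ)) μ :=
  𝓔.sectionSpace.integrable_inner s t

lemma integrable_norm_mul_norm_eval (s t : 𝓔.sectionSpace.PreL2) :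
    Integrable (fun x => ‖eval s x‖ * ‖eval t x‖) μ := by
  have hs := 𝓔.sectionSpace.integrable_sq (𝓔.sectionSpace.energy_sec_lt s)
  have ht := 𝓔.sectionSpace.integrable_sq (𝓔.sectionSpace.energy_sec_lt t)
  have hm := fun u : 𝓔.sectionSpace.PreL2 =>
    𝓔.sectionSpace.aemeasurable_norm (𝓔.sectionSpace.sec u)
  refine (hs.add ht).mono' ((hm s).mul (hm t)).aestronglyMeasurable
    (Eventually.of_forall fun x => ?_)
  rw [Real.norm_of_nonneg (by positivity)]
  show ‖eval s x‖ * ‖eval t x‖ ≤ ‖eval s x‖ ^ 2 + ‖eval t x‖ ^ 2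
  nlinarith [sq_nonneg (‖eval s x‖ - ‖eval t x‖), sq_nonneg (‖eval s x‖), sq_nonneg (‖eval t x‖)]

variable {U : ∀ x, UnitaryRep G (E x)} (hU : 𝓔.IsMeasurableRep U)

/-- As for `exists_masslessRep_mk`, the representative satisfies the fibre formula at every point,
so formulas for sums and powers follow without discarding null sets. -/
lemma exists_directIntegralRep_mk (g : G) (s : 𝓔.sectionSpace.PreL2) :
    ∃ s' : 𝓔.sectionSpace.PreL2,
      𝓔.directIntegralRep U hU g (SeparationQuotient.mk s) = SeparationQuotient.mk s' ∧
      ∀ x, eval s' x = U x g (eval s x) :=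
  ⟨_, rfl, fun _ => rfl⟩

lemma exists_walk_mk (a b : G) (s : 𝓔.sectionSpace.PreL2) :
    ∃ s' : 𝓔.sectionSpace.PreL2,
      walk (𝓔.directIntegralRep U hU) a b (SeparationQuotient.mk s) = SeparationQuotient.mk s' ∧
      ∀ x, eval s' x = walk (U x) a b (eval s x) := by
  obtain ⟨s1, e1, h1⟩ := exists_directIntegralRep_mk hU a s
  obtain ⟨s2, e2, h2⟩ := exists_directIntegralRep_mk hU a⁻¹ s
  obtain ⟨s3, e3, h3⟩ := exists_directIntegralRep_mk hU b s
  obtain ⟨s4, e4, h4⟩ := exists_directIntegralRep_mk hU b⁻¹ s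
  refine ⟨(1 / 4 : ℂ) • (s1 + s2 + s3 + s4), ?_, fun x => ?_⟩
  · rw [walk_apply]
    exact congrArg (fun v => (1 / 4 : ℂ) • v)
      (congrArg₂ (· + ·) (congrArg₂ (· + ·) (congrArg₂ (· + ·) e1 e2) e3) e4)
  · rw [walk_apply, ← h1, ← h2, ← h3, ← h4]
    rfl

lemma exists_walk_pow_mk (a b : G) (k : ℕ) (s : 𝓔.sectionSpace.PreL2) :
    ∃ s' : 𝓔.sectionSpace.PreL2,
      (walk (𝓔.directIntegralRep U hU) a b ^ k) (SeparationQuotient.mk s)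
        = SeparationQuotient.mk s' ∧
      ∀ x, eval s' x = (walk (U x) a b ^ k) (eval s x) := by
  induction k with
  | zero => exact ⟨s, rfl, fun _ => rfl⟩
  | succ k ih =>
    obtain ⟨s', e, h⟩ := ih
    obtain ⟨s'', e', h'⟩ := exists_walk_mk hU a b s'
    refine ⟨s'', ?_, fun x => ?_⟩
    · rw [pow_succ', ← e', ← e]
      rfl
    · rw [pow_succ', h', h]
      rfl

end MeasurableField

/-! ### A countable subgroup of `G_W` -/

/-- The isomorphism `h ↦ g h g⁻¹` from `G̃₃` onto `G̃_W`. -/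
def conjW (g : Poincare) : Gt3 ≃* GtW g := (MulAut.conj g).subgroupMap Gt3

lemma masslessRepW_conjW (g : Poincare) (r : ℝ) (n : Fin 4) (k : Gt3) :
    masslessRepW g r n (conjW g k) = masslessRep r n k :=
  congrArg (masslessRep r n) ((conjW g).symm_apply_apply k)

/-- The subgroup of `G_W` generated by the rational translations, boosts and rotations. -/
def rationalSubgroup (g : Poincare) : Subgroup (GtW g) :=
  Subgroup.closure (Set.range fun p : (Fin 4 → ℚ) ⊕ (ℚ × ℚ) =>
    conjW g (Sum.elim (fun q => transG fun i => q i) (fun s => boostRotG s.1 s.2) p))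

/-- The subgroup is the image of a free group on countably many generators. Countability allows a
statement that holds almost everywhere for each group element to hold almost everywhere for all of
them together. -/
instance (g : Poincare) : Countable (rationalSubgroup g) := by
  rw [rationalSubgroup, ← FreeGroup.range_lift_eq_closure]
  exact (Set.countable_range _).to_subtype

lemma conjW_mem_GW (g : Poincare) {k : Gt3} (hk : k.1.right ∈ G30) :
    (conjW g k : Poincare) ∈ GW g :=
  ⟨k.1, hk, rfl⟩

lemma conjW_transG_mem_GW (g : Poincare) (a : Minkowski) : (conjW g (transG a) : Poincare) ∈ GW g :=
  conjW_mem_GW g (one_mem G30)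

lemma conjW_boostRotG_mem_GW (g : Poincare) (t θ : ℝ) :
    (conjW g (boostRotG t θ) : Poincare) ∈ GW g :=
  conjW_mem_GW g (boostRot_mem t θ)

lemma mem_GW_of_mem_rationalSubgroup {g : Poincare} {h : GtW g} (hh : h ∈ rationalSubgroup g) :
    (h : Poincare) ∈ GW g := by
  have hle : rationalSubgroup g ≤ (GW g).subgroupOf (GtW g) := by
    rw [rationalSubgroup, Subgroup.closure_le]
    rintro _ ⟨q | s, rfl⟩
    · exact conjW_transG_mem_GW g _
    · exact conjW_boostRotG_mem_GW g _ _
  exact hle hh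

/-- Irreducibility enters here: what commutes with the rational subgroup is a scalar and so commutes
with every `w`, including those that flip the wedge. -/
lemma commutantFixes_masslessRepW (g : Poincare) {r : ℝ} (hr : 0 < r) (n : Fin 4) (w : GtW g) :
    CommutantFixes (masslessRepW g r n) (rationalSubgroup g) w := by
  intro T hT x
  have hgen : ∀ p : (Fin 4 → ℚ) ⊕ (ℚ × ℚ), conjW g (Sum.elim (fun q => transG fun i => q i)
      (fun s => boostRotG s.1 s.2) p) ∈ rationalSubgroup g := fun p =>
    Subgroup.subset_closure ⟨p, rfl⟩
  obtain ⟨c, hc⟩ := exists_eq_smul_of_commute hr T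
    (fun q y => by
      rw [← masslessRepW_conjW g]
      exact hT _ (hgen (Sum.inl q)) y)
    (fun s y => by
      rw [← masslessRepW_conjW g]
      exact hT _ (hgen (Sum.inr s)) y)
  rw [hc, hc, map_smul]

/-! ### Decomposition over `r` -/

/-- A central limit theorem: `N m` steps of length `N^(-1/2)` produce a Gaussian factor. The limit
is a scalar on the fibre that depends on `r` but not on `n`, so these powers separate the fibres by
`r`. -/
lemma tendsto_walk_pow_of_isMultipleOf {H : Type*} [NormedAddCommGroup H] [InnerProductSpace ℂ H]
    (g : Poincare) {r : ℝ} {n : Fin 4} {U : UnitaryRep (GtW g) H}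
    (hU : U.IsMultipleOf (masslessRepW g r n)) (m : ℕ) (x : H) :
    Tendsto (fun N : ℕ => (walk U (conjW g (transG (Pi.single 1 (√N)⁻¹)))
        (conjW g (transG (Pi.single 2 (√N)⁻¹))) ^ (N * m)) x) atTop
      (𝓝 ((Real.exp (-(r ^ 2 / 4)) : ℂ) ^ m • x)) := by
  rw [tendsto_iff_norm_sub_tendsto_zero]
  have hlim : Tendsto (fun N : ℕ => m * r ^ 4 * ‖x‖ / (N : ℝ)) atTop (𝓝 0) :=
    tendsto_const_div_atTop_nhds_zero_nat _
  refine squeeze_zero' (Eventually.of_forall fun _ => norm_nonneg _) ?_ hlim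
  -- The ceiling ensures that the scaled momentum `r / √N` is at most `1`; the added `1` ensures `N
  -- > 0` even when `r = 0`.
  filter_upwards [eventually_ge_atTop (⌈r ^ 2⌉₊ + 1)] with N hN
  have hN1 : r ^ 2 ≤ N := (Nat.le_ceil _).trans (by exact_mod_cast (Nat.le_succ _).trans hN)
  have hN0 : (0 : ℝ) < N := by
    have : 0 < N := by omega
    exact_mod_cast this
  have hsq : ((√N)⁻¹ * r) ^ 2 = r ^ 2 / N := by
    rw [mul_pow, inv_pow, Real.sq_sqrt hN0.le]
    ring
  have hle : |(√N)⁻¹ * r| ≤ 1 := by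
    rw [← sq_le_one_iff_abs_le_one, hsq]
    exact (div_le_one hN0).2 hN1
  have h1 := norm_walk_sub_smul_le_of_isMultipleOf hU
    (a := conjW g (transG (Pi.single 1 (√N)⁻¹))) (b := conjW g (transG (Pi.single 2 (√N)⁻¹)))
    (c := (Real.exp (-(((√N)⁻¹ * r) ^ 2 / 4)) : ℂ)) (δ := ((√N)⁻¹ * r) ^ 4) (by positivity)
    (fun y => by
      rw [walk_apply, ← map_inv, ← map_inv]
      simp only [masslessRepW_conjW]
      exact norm_walk_masslessRep_sub_smul_le n hle y)
  have h2 := norm_pow_sub_smul_le (norm_walk_apply_le U _ _) (by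
    rw [Complex.norm_real, Real.norm_of_nonneg (Real.exp_pos _).le]
    exact Real.exp_le_one_iff.2 (by simp; positivity)) h1 (N * m) x
  have e1 : (Real.exp (-(((√N)⁻¹ * r) ^ 2 / 4)) : ℂ) ^ (N * m)
      = (Real.exp (-(r ^ 2 / 4)) : ℂ) ^ m := by
    rw [pow_mul, ← Complex.ofReal_pow, ← Real.exp_nat_mul, hsq]
    congr 3
    field_simp
  -- There are `N m` steps, each with an error of at most `(r²/N)²`, for a total of `m r⁴ / N`.
  have e2 : ((N * m : ℕ) : ℝ) * ((√N)⁻¹ * r) ^ 4 * ‖x‖ = m * r ^ 4 * ‖x‖ / N := by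
    rw [show ((√N)⁻¹ * r) ^ 4 = (((√N)⁻¹ * r) ^ 2) ^ 2 by ring, hsq]
    push_cast
    field_simp
  rw [e1, e2] at h2
  exact h2

open MeasurableField in
/-- If `T` commutes with `U(h)` for `h ∈ G_W`, then the matrix coefficients of `T` and of its adjoint
agree fibrewise. -/
lemma ae_inner_eval_eq (g : Poincare) {μ : Measure (Set.Ioi (0 : ℝ))}
    {E : Set.Ioi (0 : ℝ) → Type*} [∀ r, NormedAddCommGroup (E r)]
    [∀ r, InnerProductSpace ℂ (E r)] [∀ r, CompleteSpace (E r)]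
    {𝓔 : MeasurableField μ E} {U : ∀ r, UnitaryRep (GtW g) (E r)} (hU : 𝓔.IsMeasurableRep U)
    (hmult : ∀ᵐ r ∂μ, ∃ n : Fin 4, (U r).IsMultipleOf (masslessRepW g r n))
    (T : 𝓔.directIntegral →L[ℂ] 𝓔.directIntegral)
    (hT : ∀ h : GtW g, (h : Poincare) ∈ GW g → ∀ x,
      T (𝓔.directIntegralRep U hU h x) = 𝓔.directIntegralRep U hU h (T x))
    {s s' t t' : 𝓔.sectionSpace.PreL2}
    (hs : ContinuousLinearMap.adjoint T (SeparationQuotient.mk s) = SeparationQuotient.mk s')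
    (ht : T (SeparationQuotient.mk t) = SeparationQuotient.mk t') :
    ∀ᵐ r ∂μ, (⟪eval s' r, eval t r⟫_ℂ : ℂ) = ⟪eval s r, eval t' r⟫_ℂ := by
  have hstd : StandardBorelSpace (Set.Ioi (0 : ℝ)) := measurableSet_Ioi.standardBorel
  -- Injectivity uses `r > 0`: the Gaussian factor only knows `r²`.
  have hinj : Function.Injective fun r : Set.Ioi (0 : ℝ) => Real.exp (-((r : ℝ) ^ 2 / 4)) := by
    intro r₁ r₂ h
    have h1 := Real.exp_injective h
    have h2 : (r₁ : ℝ) ^ 2 = (r₂ : ℝ) ^ 2 := by linarith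
    exact Subtype.ext ((sq_eq_sq₀ r₁.2.le r₂.2.le).1 h2)
  -- The difference of the two coefficients is an integrable function of `r`; its moments against
  -- `exp(-r²/4)` are limits of matrix coefficients of powers of the walk, and these limits vanish.
  have hzero := ae_eq_zero_of_integral_pow (ν := μ)
    (u := fun r : Set.Ioi (0 : ℝ) => Real.exp (-((r : ℝ) ^ 2 / 4))) (by fun_prop) hinj
    (fun r => by
      rw [abs_of_pos (Real.exp_pos _)]
      exact Real.exp_le_one_iff.2 (by simp; positivity))
    ((integrable_inner_eval s' t).sub (integrable_inner_eval s t')) (fun m => by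
      set a : ℕ → GtW g := fun N => conjW g (transG (Pi.single 1 (√N)⁻¹)) with ha
      set b : ℕ → GtW g := fun N => conjW g (transG (Pi.single 2 (√N)⁻¹)) with hb
      have hcomm : ∀ N k x, T ((walk (𝓔.directIntegralRep U hU) (a N) (b N) ^ k) x)
          = (walk (𝓔.directIntegralRep U hU) (a N) (b N) ^ k) (T x) := by
        intro N k x
        have h1 : Commute T (walk (𝓔.directIntegralRep U hU) (a N) (b N)) := by
          have hop : ∀ h : GtW g, (h : Poincare) ∈ GW g →
              Commute T ((𝓔.directIntegralRep U hU).op h) := fun h hh =>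
            ContinuousLinearMap.ext fun x => hT h hh x
          have hA := conjW_transG_mem_GW g (Pi.single 1 (√N)⁻¹)
          have hB := conjW_transG_mem_GW g (Pi.single 2 (√N)⁻¹)
          exact ((((hop _ hA).add_right (hop _ (inv_mem hA))).add_right (hop _ hB)).add_right
            (hop _ (inv_mem hB))).smul_right _
        exact DFunLike.congr_fun (h1.pow_right k).eq x
      choose p hp1 hp2 using fun N : ℕ => exists_walk_pow_mk hU (a N) (b N) (N * m) t
      choose p' hp1' hp2' using fun N : ℕ => exists_walk_pow_mk hU (a N) (b N) (N * m) t'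
      -- Before the limit, the integral is `⟪T* s, A t⟫ - ⟪s, A (T t)⟫` with `A` a power of the
      -- walk, which is zero because `T` commutes with `A`.
      have hcoeff : ∀ N, ∫ r, ((⟪eval s' r, eval (p N) r⟫_ℂ : ℂ) - ⟪eval s r, eval (p' N) r⟫_ℂ) ∂μ
          = 0 := by
        intro N
        rw [integral_sub (integrable_inner_eval _ _) (integrable_inner_eval _ _), ← inner_mk_mk,
          ← inner_mk_mk, ← hs, ContinuousLinearMap.adjoint_inner_left, ← hp1, hcomm, ht, hp1',
          sub_self]
      -- The walk is a contraction in every fibre, so products of the norms of the original vector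
      -- fields dominate uniformly in `N`.
      have hlim := tendsto_integral_of_dominated_convergence (μ := μ)
        (F := fun (N : ℕ) r =>
          (⟪eval s' r, eval (p N) r⟫_ℂ : ℂ) - ⟪eval s r, eval (p' N) r⟫_ℂ)
        (f := fun r => ((Real.exp (-((r : ℝ) ^ 2 / 4)) : ℝ) : ℂ) ^ m
          * ((⟪eval s' r, eval t r⟫_ℂ : ℂ) - ⟪eval s r, eval t' r⟫_ℂ))
        (fun r => ‖eval s' r‖ * ‖eval t r‖ + ‖eval s r‖ * ‖eval t' r‖)
        (fun N => ((integrable_inner_eval s' (p N)).sub (integrable_inner_eval s (p' N))).1)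
        ((integrable_norm_mul_norm_eval s' t).add (integrable_norm_mul_norm_eval s t'))
        (fun N => Eventually.of_forall fun r => by
          refine (norm_sub_le _ _).trans (add_le_add ?_ ?_)
          · refine (norm_inner_le_norm _ _).trans ?_
            rw [hp2]
            exact mul_le_mul_of_nonneg_left
              (norm_pow_apply_le (norm_walk_apply_le _ _ _) _ _) (norm_nonneg _)
          · refine (norm_inner_le_norm _ _).trans ?_
            rw [hp2']
            exact mul_le_mul_of_nonneg_left
              (norm_pow_apply_le (norm_walk_apply_le _ _ _) _ _) (norm_nonneg _))
        (by
          filter_upwards [hmult] with r hr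
          obtain ⟨n, hn⟩ := hr
          have h1 := tendsto_walk_pow_of_isMultipleOf g hn m (eval t r)
          have h2 := tendsto_walk_pow_of_isMultipleOf g hn m (eval t' r)
          have h3 := ((tendsto_const_nhds (x := eval s' r)).inner h1 (𝕜 := ℂ)).sub
            ((tendsto_const_nhds (x := eval s r)).inner h2 (𝕜 := ℂ))
          rw [inner_smul_right, inner_smul_right, ← mul_sub] at h3
          refine h3.congr fun N => ?_
          rw [hp2, hp2'])
      simp only [hcoeff] at hlim
      exact tendsto_nhds_unique hlim tendsto_const_nhds)
  filter_upwards [hzero] with r hr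
  exact sub_eq_zero.1 hr

open MeasurableField in
-- All data are matrix coefficients of fixed vector fields `s` and `t`. Each exceptional null set
-- depends on `s`, `t` and one group element, which is why only a countable subgroup is used before
-- passing to `w` inside the fibre.
lemma commute_directIntegralRep (g : Poincare) {μ : Measure (Set.Ioi (0 : ℝ))}
    {E : Set.Ioi (0 : ℝ) → Type*} [∀ r, NormedAddCommGroup (E r)]
    [∀ r, InnerProductSpace ℂ (E r)] [∀ r, CompleteSpace (E r)]
    {𝓔 : MeasurableField μ E} {U : ∀ r, UnitaryRep (GtW g) (E r)} (hU : 𝓔.IsMeasurableRep U)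
    (hmult : ∀ᵐ r ∂μ, ∃ n : Fin 4, (U r).IsMultipleOf (masslessRepW g r n))
    (T : 𝓔.directIntegral →L[ℂ] 𝓔.directIntegral)
    (hT : ∀ h : GtW g, (h : Poincare) ∈ GW g → ∀ x,
      T (𝓔.directIntegralRep U hU h x) = 𝓔.directIntegralRep U hU h (T x))
    (w : GtW g) (x : 𝓔.directIntegral) :
    T (𝓔.directIntegralRep U hU w x) = 𝓔.directIntegralRep U hU w (T x) := by
  refine ext_inner_left ℂ fun y => ?_
  obtain ⟨t, rfl⟩ := SeparationQuotient.surjective_mk x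
  obtain ⟨s, rfl⟩ := SeparationQuotient.surjective_mk y
  obtain ⟨t', ht⟩ := SeparationQuotient.surjective_mk (T (SeparationQuotient.mk t))
  obtain ⟨s', hs⟩ := SeparationQuotient.surjective_mk
    (ContinuousLinearMap.adjoint T (SeparationQuotient.mk s))
  have hcoef : ∀ᵐ r ∂μ, ∀ h : rationalSubgroup g,
      (⟪eval s' r, U r h (eval t r)⟫_ℂ : ℂ) = ⟪eval s r, U r h (eval t' r)⟫_ℂ := by
    rw [ae_all_iff]
    intro h
    obtain ⟨p, hp1, hp2⟩ := exists_directIntegralRep_mk hU (h : GtW g) t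
    obtain ⟨p', hp1', hp2'⟩ := exists_directIntegralRep_mk hU (h : GtW g) t'
    have h1 : T (SeparationQuotient.mk p) = SeparationQuotient.mk p' := by
      rw [← hp1, hT _ (mem_GW_of_mem_rationalSubgroup h.2), ← ht, hp1']
    filter_upwards [ae_inner_eval_eq g hU hmult T hT hs.symm h1] with r hr
    rwa [hp2, hp2'] at hr
  obtain ⟨p, hp1, hp2⟩ := exists_directIntegralRep_mk hU w t
  obtain ⟨p', hp1', hp2'⟩ := exists_directIntegralRep_mk hU w t'
  rw [← ContinuousLinearMap.adjoint_inner_left, ← hs, ← ht, hp1, hp1', inner_mk_mk, inner_mk_mk]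
  refine integral_congr_ae ?_
  filter_upwards [hcoef, hmult] with r h1 h2
  obtain ⟨n, hn⟩ := h2
  rw [hp2, hp2']
  -- In this fibre `n` is fixed, and the identity on the rational subgroup extends to `w` because `U
  -- r` is a multiple of a representation irreducible under that subgroup.
  exact ((commutantFixes_masslessRepW g r.2 n w).of_isMultipleOf hn).inner_eq_inner
    fun k hk => h1 ⟨k, hk⟩

end MasslessMC

end

theorem proposition4p4 (g : MasslessMC.Poincare) (μ : Measure (Set.Ioi (0 : ℝ)))
    (E : Set.Ioi (0 : ℝ) → Type*) [∀ r, NormedAddCommGroup (E r)]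
    [∀ r, InnerProductSpace ℂ (E r)] [∀ r, CompleteSpace (E r)]
    (𝓔 : MasslessMC.MeasurableField μ E)
    (U : ∀ r, MasslessMC.UnitaryRep (MasslessMC.GtW g) (E r)) (hU : 𝓔.IsMeasurableRep U)
    (hmult : ∀ᵐ r ∂μ, ∃ n : Fin 4, (U r).IsMultipleOf (MasslessMC.masslessRepW g r n)) :
    MasslessMC.ModularityCondition g (𝓔.directIntegralRep U hU) := by
  intro w _ T hT
  refine ContinuousLinearMap.ext fun x => ?_
  refine MasslessMC.commute_directIntegralRep g hU hmult T (fun h hh y => ?_) w x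
  exact (DFunLike.congr_fun (hT _ ⟨h, hh, rfl⟩) y).symm
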